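/- Let $m,n$ be nonnegative integers, let $x\in\mathbb{R}^n$ and $w\in\mathbb{R}^m$ be arbitrary fixed vectors, and let $f:\mathbb{R}^n\to\mathbb{R}$ be a proper function, i.e. a function all of whose sub-level sets $\{z: f(z)\le c\}$ are closed. Let $\mathcal{C}$ be a cone of descent of $f$ at $x$, i.e. a closed cone (not necessarily convex) containing the descent set $\{h\in\mathbb{R}^n: f(x+h)\le f(x)\}$; for instance the smallest such cone. Let $\mathcal{B}^n$ be the closed Euclidean unit ball, let $$\omega=\mathbb{E}\Big[\sup_{z\in\mathcal{C}\cap\mathcal{B}^n}\langle g,z\rangle\Big],\qquad g\sim\mathcal{N}(0,I_n),$$ be the Gaussian width of $\mathcal{C}\cap\mathcal{B}^n$, and let $\phi(t)=\sqrt{2}\,\Gamma(\frac{t+1}{2})/\Gamma(\frac{t}{2})$ for $t>0$ and $\phi(0)=0$, an increasing bijection of $[0,\infty)$. Let $\eta\ge 0$ and put $m_0=\phi^{-1}(\omega+\eta)$. Let $\kappa_f=1$ if $f$ is convex and $\kappa_f=2$ if $f$ is not convex. Let $A\in\mathbb{R}^{m\times n}$ be a random matrix with independent $\mathcal{N}(0,1)$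 entries, let $y=Ax+w$, let $\mathcal{K}=\{z\in\mathbb{R}^n: f(z)\le f(x)\}$, and let $\mu=1/b_m^2$ with $b_m=\phi(m)$ (so that $\mu\approx 1/m$). Consider projected gradient descent $$z_0=0,\qquad z_{\tau+1}=\mathcal{P}_{\mathcal{K}}\big(z_\tau+\mu A^{*}(y-Az_\tau)\big),$$ where $\mathcal{P}_{\mathcal{K}}(v)$ denotes a point of $\mathcal{K}$ closest to $v$ in Euclidean norm (if there are several, any of them may be chosen at each step). If $$m>8\kappa_f^2m_0,$$ then there is an event of probability at least $1-9e^{-\eta^2/8}$ on which, for every such sequence $(z_\tau)$ and every $\tau\ge 0$, $$\|z_\tau-x\|\le\left(\frac{8\kappa_f^2m_0}{m}\right)^{\tau/2}\|x\|+\sqrt{\frac{\pi}{2}}\,\frac{\kappa_f}{1-\sqrt{8\kappa_f^2\frac{m_0}{m}}}\,\frac{\sqrt{m_0}}{m}\,\|w\|.$$ -/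

import Mathlib

open MeasureTheory ProbabilityTheory

noncomputable section

namespace PGD

/-- A proper function, in the sense that all its sub-level sets are closed. -/
def IsProperFun {n : ℕ} (f : EuclideanSpace ℝ (Fin n) → ℝ) : Prop :=
  ∀ c : ℝ, IsClosed {z | f z ≤ c}

/-- The set of descent of `f` at `x`. -/
def descentSet {n : ℕ} (f : EuclideanSpace ℝ (Fin n) → ℝ) (x : EuclideanSpace ℝ (Fin n)) :
    Set (EuclideanSpace ℝ (Fin n)) :=
  {h | f (x + h) ≤ f x}

/-- `C` is a cone of descent of `f` at `x`: a closed (not necessarily convex) cone that contains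
the set of descent. The smallest such cone is the tangent cone. As `0` lies in the set of descent,
it lies in `C`. -/
structure IsDescentCone {n : ℕ} (f : EuclideanSpace ℝ (Fin n) → ℝ) (x : EuclideanSpace ℝ (Fin n))
    (C : Set (EuclideanSpace ℝ (Fin n))) : Prop where
  isClosed : IsClosed C
  smul_mem : ∀ t : ℝ, 0 < t → ∀ u ∈ C, t • u ∈ C
  descentSet_subset : descentSet f x ⊆ C

/-- The Gaussian width `𝔼 sup_{z ∈ S} ⟨g, z⟩`, with `g` a standard Gaussian vector (used here for
nonempty bounded sets `S`, where the supremum is finite and integrable in `g`). -/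
def gaussianWidth {n : ℕ} (S : Set (EuclideanSpace ℝ (Fin n))) : ℝ :=
  ∫ g, sSup ((fun z => inner ℝ g z) '' S) ∂(stdGaussian (EuclideanSpace ℝ (Fin n)))

/-- `φ(t) = √2 Γ((t+1)/2) / Γ(t/2)`. Since `Real.Gamma 0 = 0` and `a / 0 = 0`, this gives
`φ(0) = 0`, which is the limit of `φ` at `0`. -/
def phi (t : ℝ) : ℝ :=
  √2 * Real.Gamma ((t + 1) / 2) / Real.Gamma (t / 2)

/-- The phase transition function `φ⁻¹(ω(C ∩ B) + η)`, where `B` is the closed Euclidean unit ball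
and `φ⁻¹` is the inverse of the increasing bijection `φ : [0, ∞) → [0, ∞)`. -/
def phaseTransition {n : ℕ} (C : Set (EuclideanSpace ℝ (Fin n))) (η : ℝ) : ℝ :=
  Function.invFunOn phi (Set.Ici 0) (gaussianWidth (C ∩ Metric.closedBall 0 1) + η)

open Classical in
/-- The constant equal to `1` for convex `f` and to `2` for non-convex `f`. -/
def kappa {n : ℕ} (f : EuclideanSpace ℝ (Fin n) → ℝ) : ℝ :=
  if ConvexOn ℝ Set.univ f then 1 else 2

/-- `p` is a Euclidean projection of `v` onto `K`, that is, a minimizer over `K` of the distance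
to `v`. It is unique if `K` is convex, but need not be so otherwise. -/
def IsProjection {n : ℕ} (K : Set (EuclideanSpace ℝ (Fin n))) (v p : EuclideanSpace ℝ (Fin n)) :
    Prop :=
  p ∈ K ∧ ∀ q ∈ K, ‖v - p‖ ≤ ‖v - q‖

/-- `z` is a run of projected gradient descent for `y` and `A` over `K`, with step size `μ` and
with `z 0 = 0`: every `z (τ + 1)` is a projection of `z τ + μ Aᵀ (y - A (z τ))` onto `K`. -/
structure IsPGDRun {m n : ℕ} (K : Set (EuclideanSpace ℝ (Fin n))) (A : Matrix (Fin m) (Fin n) ℝ)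
    (y : EuclideanSpace ℝ (Fin m)) (μ : ℝ) (z : ℕ → EuclideanSpace ℝ (Fin n)) : Prop where
  zero : z 0 = 0
  succ : ∀ τ : ℕ, IsProjection K
    (z τ + μ • A.transpose.toEuclideanLin (y - A.toEuclideanLin (z τ))) (z (τ + 1))

/-- `A` is a Gaussian map: a random matrix with independent `N(0,1)` entries. -/
structure IsGaussianMap {Ω : Type*} [MeasurableSpace Ω] {m n : ℕ}
    (A : Ω → Matrix (Fin m) (Fin n) ℝ) (P : Measure Ω) : Prop where
  hasLaw : ∀ i j, HasLaw (fun ω => A ω i j) (gaussianReal 0 1) P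
  indep : iIndepFun (fun (p : Fin m × Fin n) ω => A ω p.1 p.2) P

end PGD

end

/-! Write `h = z τ - x` and `h' = z (τ+1) - x`. If `v` is the point being projected, then `‖h'‖² ≤ κ
⟨v - x, h'⟩` (`IsProjection.norm_sub_sq_le`), and `v - x = h + μ Aᵀ(w - A h)`. Dividing by the
norms, one step is controlled by `⟨u, u'⟩ - μ ⟨A u, A u'⟩` and `⟨w, A u'⟩`, where `u`, `u'` are the
directions of `h`, `h'`; these must be bounded uniformly over `T = C ∩ closedBall 0 1`.

By polarization the first quantity needs only a lower bound for `‖A (u + u')‖` and an upper bound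
for `‖A (u - u')‖`, each equal to `b ‖·‖` up to an additive error `δ` (`inner_sub_inner_map_le`),
where `b = φ(m)` is the mean norm of a standard Gaussian vector of dimension `m`. With `δ = 2(ω + η)
= 2φ(m₀)` the contraction factor is `κ √2 δ / b = κ √8 φ(m₀)/φ(m)`. It is at most `√(8κ² m₀/m)`
because `φ(t)²/t` is increasing (`phi_sq_div_mono`). The same monotonicity gives `φ(m)² ≥ 2m/π`, the
source of `√(π/2)` in the noise term.

The two norm bounds are the Gordon and Chevet min-max theorems in exponential form
(`integral_exp_sup_norm_le`). They and Gaussian concentration both come from one interpolation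
principle, `HasBddDeriv₂.integral_exp_le_integral_exp`, applied to different smooth functions `G`.
Finite families are treated by softmax, and `T` by a dense sequence.

The initial error `-x` need not lie in `C`. Its direction is therefore added as one extra point,
which costs no Gaussian width but two more exceptional events. -/

/-- The law of a family of independent standard Gaussian variables. -/
noncomputable abbrev gaussianPi (ι : Type*) [Fintype ι] : Measure (ι → ℝ) :=
  Measure.pi fun _ => gaussianReal 0 1

/-! ### Gaussian integration by parts. -/

lemma integrable_exp_mul_abs_gaussianReal (c : ℝ) :
    Integrable (fun t => Real.exp (c * |t|)) (gaussianReal 0 1) :=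
  integrable_exp_mul_abs (integrable_exp_mul_gaussianReal c) (integrable_exp_mul_gaussianReal (-c))

/-- Gaussian integration by parts on the real line. -/
lemma integral_mul_gaussianReal {h h' : ℝ → ℝ} (hd : ∀ t, HasDerivAt h (h' t) t)
    (h0 : Integrable h (gaussianReal 0 1)) (h1 : Integrable (fun t => t * h t) (gaussianReal 0 1))
    (h2 : Integrable h' (gaussianReal 0 1)) :
    ∫ t, t * h t ∂(gaussianReal 0 1) = ∫ t, h' t ∂(gaussianReal 0 1) := by
  have key : ∀ f : ℝ → ℝ, Integrable f (gaussianReal 0 1) →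
      Integrable (fun t => gaussianPDFReal 0 1 t * f t) := by
    intro f hf
    rw [gaussianReal_of_var_ne_zero 0 one_ne_zero] at hf
    rw [integrable_withDensity_iff_integrable_smul' (by fun_prop)
      (Filter.Eventually.of_forall fun _ => gaussianPDF_lt_top)] at hf
    simpa [gaussianPDF, ENNReal.toReal_ofReal (gaussianPDFReal_nonneg _ _ _)] using hf
  -- The density solves `p' = -t p`, so the claim is ordinary integration by parts against `p`.
  have hpdf : ∀ t, HasDerivAt (gaussianPDFReal 0 1) (-(t * gaussianPDFReal 0 1 t)) t := by
    intro t
    have : HasDerivAt (fun x : ℝ => (√(2 * Real.pi * ((1 : NNReal) : ℝ)))⁻¹ *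
        Real.exp (-(x - 0) ^ 2 / (2 * ((1 : NNReal) : ℝ)))) 
        ((√(2 * Real.pi * ((1 : NNReal) : ℝ)))⁻¹ *
        (Real.exp (-(t - 0) ^ 2 / (2 * ((1 : NNReal) : ℝ))) * (-t))) t := by
      refine HasDerivAt.const_mul _ (HasDerivAt.exp ?_)
      have := ((((hasDerivAt_id t).sub_const 0).pow 2).neg).div_const (2 * ((1 : NNReal) : ℝ))
      exact this.congr_deriv (by norm_num; ring)
    rw [gaussianPDFReal_def]
    convert this using 1
    ring
  rw [integral_gaussianReal_eq_integral_smul one_ne_zero,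
    integral_gaussianReal_eq_integral_smul one_ne_zero]
  have := integral_mul_deriv_eq_deriv_mul_of_integrable (u := h) (u' := h')
    (v := gaussianPDFReal 0 1) (v' := fun t => -(t * gaussianPDFReal 0 1 t))
    (fun t _ => hd t) (fun t _ => hpdf t)
    (by have := (key _ h1).neg; refine this.congr (ae_of_all _ fun t => ?_); simp; ring)
    (by refine (key _ h2).congr (ae_of_all _ fun t => ?_); simp; ring)
    (by refine (key _ h0).congr (ae_of_all _ fun t => ?_); simp; ring)
  simp only [smul_eq_mul]
  calc ∫ t, gaussianPDFReal 0 1 t * (t * h t) = -∫ t, h t * -(t * gaussianPDFReal 0 1 t) := by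
        rw [← integral_neg]; congr 1; ext t; ring
    _ = ∫ t, gaussianPDFReal 0 1 t * h' t := by
        rw [this, neg_neg]; congr 1; ext t; ring

section Pi

variable {ι : Type*} [Fintype ι]

/-- Resampling one coordinate independently does not change the law. With Fubini this reduces
integration by parts in coordinate `k` to the one-dimensional case. -/
lemma measurePreserving_update_pi [DecidableEq ι] (k : ι) :
    MeasurePreserving (fun p : (ι → ℝ) × ℝ => Function.update p.1 k p.2)
      ((gaussianPi ι).prod (gaussianReal 0 1)) (gaussianPi ι) := by
  have hm : Measurable (fun p : (ι → ℝ) × ℝ => Function.update p.1 k p.2) := by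
    refine measurable_pi_lambda _ fun i => ?_
    by_cases h : i = k
    · subst h; simpa using measurable_snd
    · simp only [Function.update_of_ne h]; fun_prop
  refine ⟨hm, (Measure.pi_eq fun s hs => ?_).symm⟩
  rw [Measure.map_apply hm (MeasurableSet.univ_pi hs)]
  have : (fun p : (ι → ℝ) × ℝ => Function.update p.1 k p.2) ⁻¹' Set.univ.pi s =
      (Set.univ.pi (Function.update s k Set.univ)) ×ˢ (s k) := by
    ext p
    simp only [Set.mem_preimage, Set.mem_pi, Set.mem_univ, true_implies, Set.mem_prod]
    constructor
    · intro h
      refine ⟨fun i => ?_, by simpa using h k⟩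
      by_cases hi : i = k
      · subst hi; simp
      · simpa [Function.update_of_ne hi] using h i
    · rintro ⟨h1, h2⟩ i
      by_cases hi : i = k
      · subst hi; simpa using h2
      · simpa [Function.update_of_ne hi] using h1 i
  rw [this, Measure.prod_prod, Measure.pi_pi, ← Finset.prod_erase_mul _ _ (Finset.mem_univ k),
    ← Finset.prod_erase_mul Finset.univ (fun i => gaussianReal 0 1 (s i)) (Finset.mem_univ k)]
  simp only [Function.update_self, measure_univ, mul_one]
  congr 1
  refine Finset.prod_congr rfl fun i hi => ?_
  rw [Function.update_of_ne (Finset.ne_of_mem_erase hi)]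

/-- Gaussian integration by parts in one coordinate. -/
lemma integral_eval_mul_gaussianPi [DecidableEq ι] (k : ι) {H H' : (ι → ℝ) → ℝ}
    (hd : ∀ ω, HasDerivAt (fun t => H (Function.update ω k t)) (H' ω) (ω k))
    (h0 : Integrable H (gaussianPi ι)) (h1 : Integrable (fun ω => ω k * H ω) (gaussianPi ι))
    (h2 : Integrable H' (gaussianPi ι)) :
    ∫ ω, ω k * H ω ∂(gaussianPi ι) = ∫ ω, H' ω ∂(gaussianPi ι) := by
  have mp := measurePreserving_update_pi k
  have i0 := mp.integrable_comp_of_integrable h0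
  have i1 := mp.integrable_comp_of_integrable h1
  have i2 := mp.integrable_comp_of_integrable h2
  simp only [Function.comp_def] at i0 i1 i2
  rw [← mp.map_eq, integral_map mp.aemeasurable (by rw [mp.map_eq]; exact h1.1),
    integral_map mp.aemeasurable (by rw [mp.map_eq]; exact h2.1), integral_prod _ i1,
    integral_prod _ i2]
  refine integral_congr_ae ?_
  filter_upwards [i0.prod_right_ae, i1.prod_right_ae, i2.prod_right_ae] with ω j0 j1 j2
  simp only [Function.update_self] at j0 j1 j2 ⊢
  refine integral_mul_gaussianReal (fun t => ?_) j0 j1 j2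
  have := hd (Function.update ω k t)
  simpa using this

lemma integrable_exp_mul_sum_abs (c : ℝ) :
    Integrable (fun ω => Real.exp (c * ∑ i, |ω i|)) (gaussianPi ι) := by
  have : (fun ω : ι → ℝ => Real.exp (c * ∑ i, |ω i|)) = fun ω => ∏ i, Real.exp (c * |ω i|) := by
    ext ω; rw [Finset.mul_sum, Real.exp_sum]
  rw [this]
  exact Integrable.fintype_prod (f := fun _ t => Real.exp (c * |t|))
    fun _ => integrable_exp_mul_abs_gaussianReal c

/-- Every integrand below grows at most like `exp (c ∑ |ω i|)`, so this one domination settles all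
integrability questions. -/
lemma integrable_of_le_exp_sum_abs {f : (ι → ℝ) → ℝ} (hf : AEStronglyMeasurable f (gaussianPi ι))
    (C c : ℝ) (h : ∀ ω, |f ω| ≤ C * Real.exp (c * ∑ i, |ω i|)) : Integrable f (gaussianPi ι) :=
  ((integrable_exp_mul_sum_abs c).const_mul C).mono' hf (ae_of_all _ h)

end Pi

/-! ### Gaussian interpolation and comparison of exponential moments. -/

/-- `G` has first derivative `G'` and second directional derivative `G₂ x v` at `x` along `v`, both
bounded by `K`. -/
structure HasBddDeriv₂ {E : Type*} [NormedAddCommGroup E] [NormedSpace ℝ E]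
    (G : E → ℝ) (G' : E → E →L[ℝ] ℝ) (G₂ : E → E → ℝ) (K : ℝ) : Prop where
  hasFDerivAt : ∀ x, HasFDerivAt G (G' x) x
  hasDerivAt : ∀ x v, HasDerivAt (fun t : ℝ => G' (x + t • v) v) (G₂ x v) 0
  abs_le : ∀ x v, |G' x v| ≤ K * ‖v‖
  abs_le₂ : ∀ x v, |G₂ x v| ≤ K * ‖v‖ ^ 2
  continuous₁ : ∀ v, Continuous fun x => G' x v
  continuous₂ : ∀ v, Continuous fun x => G₂ x v
  nonneg : 0 ≤ K

namespace HasBddDeriv₂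

variable {E : Type*} [NormedAddCommGroup E] [NormedSpace ℝ E]
  {G : E → ℝ} {G' : E → E →L[ℝ] ℝ} {G₂ : E → E → ℝ} {K : ℝ}

lemma continuous (h : HasBddDeriv₂ G G' G₂ K) : Continuous G :=
  continuous_iff_continuousAt.2 fun x => (h.hasFDerivAt x).continuousAt

lemma hasDerivAt_line (h : HasBddDeriv₂ G G' G₂ K) (x v : E) (t : ℝ) :
    HasDerivAt (fun t : ℝ => G (x + t • v)) (G' (x + t • v) v) t := by
  have : HasDerivAt (fun t : ℝ => x + t • v) v t := by
    simpa using ((hasDerivAt_id t).smul_const v).const_add x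
  exact (h.hasFDerivAt _).comp_hasDerivAt t this

lemma abs_sub_le (h : HasBddDeriv₂ G G' G₂ K) (x y : E) : |G y - G x| ≤ K * ‖y - x‖ := by
  have := Convex.norm_image_sub_le_of_norm_hasFDerivWithin_le (f := G) (f' := G') (C := K)
    (s := Set.univ) (x := x) (y := y) (fun z _ => (h.hasFDerivAt z).hasFDerivWithinAt)
    (fun z _ => ContinuousLinearMap.opNorm_le_bound _ h.nonneg fun v => h.abs_le z v)
    convex_univ trivial trivial
  simpa using this

lemma exp_le (h : HasBddDeriv₂ G G' G₂ K) (x : E) :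
    Real.exp (G x) ≤ Real.exp (G 0) * Real.exp (K * ‖x‖) := by
  rw [← Real.exp_add, Real.exp_le_exp]
  have := (le_abs_self _).trans (h.abs_sub_le 0 x)
  rw [sub_zero] at this
  linarith

section Path

variable {ι : Type*} [Fintype ι] {v : ι → E} {c c' : ι → ℝ → ℝ}

lemma norm_sum_smul_le (v : ι → E) {c : ι → ℝ} (hc : ∀ k, |c k| ≤ 1) (ω : ι → ℝ) :
    ‖∑ k, (ω k * c k) • v k‖ ≤ (∑ k, ‖v k‖) * ∑ k, |ω k| := by
  refine (norm_sum_le _ _).trans ?_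
  rw [Finset.mul_sum]
  refine Finset.sum_le_sum fun k _ => ?_
  rw [norm_smul, Real.norm_eq_abs, abs_mul, mul_comm]
  gcongr
  · exact Finset.single_le_sum (f := fun k => ‖v k‖) (fun _ _ => norm_nonneg _) (Finset.mem_univ k)
  · exact mul_le_of_le_one_right (abs_nonneg _) (hc k)

lemma exp_path_le (h : HasBddDeriv₂ G G' G₂ K) {c : ι → ℝ} (hc : ∀ k, |c k| ≤ 1) (ω : ι → ℝ) :
    Real.exp (G (∑ k, (ω k * c k) • v k)) ≤
      Real.exp (G 0) * Real.exp (K * (∑ k, ‖v k‖) * ∑ k, |ω k|) := by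
  refine (h.exp_le _).trans (mul_le_mul_of_nonneg_left ?_ (Real.exp_pos _).le)
  rw [Real.exp_le_exp, mul_assoc]
  exact mul_le_mul_of_nonneg_left (norm_sum_smul_le v hc ω) h.nonneg

lemma continuous_path (v : ι → E) (c : ι → ℝ) :
    Continuous fun ω : ι → ℝ => ∑ k, (ω k * c k) • v k := by fun_prop

lemma integrable_exp_path (h : HasBddDeriv₂ G G' G₂ K) {c : ι → ℝ} (hc : ∀ k, |c k| ≤ 1) :
    Integrable (fun ω => Real.exp (G (∑ k, (ω k * c k) • v k))) (gaussianPi ι) := by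
  refine integrable_of_le_exp_sum_abs
    (Real.continuous_exp.comp (h.continuous.comp (continuous_path v c))).aestronglyMeasurable
    (Real.exp (G 0)) (K * (∑ k, ‖v k‖)) fun ω => ?_
  rw [abs_of_pos (Real.exp_pos _)]
  exact h.exp_path_le hc ω

lemma integrable_eval_mul_exp_path (h : HasBddDeriv₂ G G' G₂ K) {c : ι → ℝ} (hc : ∀ k, |c k| ≤ 1)
    (k : ι) :
    Integrable (fun ω => ω k * (G' (∑ k, (ω k * c k) • v k) (v k) *
      Real.exp (G (∑ k, (ω k * c k) • v k)))) (gaussianPi ι) := by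
  have hp := continuous_path v c
  have hE : Continuous fun ω : ι → ℝ => Real.exp (G (∑ k, (ω k * c k) • v k)) :=
    Real.continuous_exp.comp (h.continuous.comp hp)
  have h1 := (h.continuous₁ (v k)).comp hp
  simp only [Function.comp_def] at h1
  refine integrable_of_le_exp_sum_abs
    ((continuous_apply k).mul (h1.mul hE)).aestronglyMeasurable
    (K * ‖v k‖ * Real.exp (G 0)) (1 + K * (∑ k, ‖v k‖)) fun ω => ?_
  rw [abs_mul, abs_mul, abs_of_pos (Real.exp_pos _), add_mul, Real.exp_add]
  have := h.nonneg
  have e1 : |ω k| ≤ Real.exp (1 * ∑ i, |ω i|) := by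
    have : |ω k| ≤ ∑ i, |ω i| := Finset.single_le_sum (f := fun i => |ω i|)
      (fun _ _ => abs_nonneg _) (Finset.mem_univ k)
    linarith [Real.add_one_le_exp (1 * ∑ i, |ω i|)]
  calc _ ≤ Real.exp (1 * ∑ i, |ω i|) * (K * ‖v k‖ *
      (Real.exp (G 0) * Real.exp (K * (∑ k, ‖v k‖) * ∑ k, |ω k|))) := by
        gcongr
        exacts [h.abs_le _ _, h.exp_path_le hc ω]
    _ = _ := by ring

lemma integrable_deriv₂_exp_path (h : HasBddDeriv₂ G G' G₂ K) {c : ι → ℝ} (hc : ∀ k, |c k| ≤ 1)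
    (k : ι) :
    Integrable (fun ω => (G₂ (∑ k, (ω k * c k) • v k) (v k) +
      G' (∑ k, (ω k * c k) • v k) (v k) ^ 2) * Real.exp (G (∑ k, (ω k * c k) • v k)))
      (gaussianPi ι) := by
  have hp := continuous_path v c
  have hE : Continuous fun ω : ι → ℝ => Real.exp (G (∑ k, (ω k * c k) • v k)) :=
    Real.continuous_exp.comp (h.continuous.comp hp)
  have h1 := (h.continuous₁ (v k)).comp hp
  have h2 := (h.continuous₂ (v k)).comp hp
  simp only [Function.comp_def] at h1 h2
  refine integrable_of_le_exp_sum_abs ((h2.add (h1.pow 2)).mul hE).aestronglyMeasurable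
    ((K * ‖v k‖ ^ 2 + (K * ‖v k‖) ^ 2) * Real.exp (G 0)) (K * (∑ k, ‖v k‖)) fun ω => ?_
  rw [abs_mul, abs_of_pos (Real.exp_pos _), mul_assoc]
  have := h.nonneg
  gcongr
  · refine (abs_add_le _ _).trans (add_le_add (h.abs_le₂ _ _) ?_)
    rw [abs_pow]
    gcongr
    exact h.abs_le _ _
  · exact h.exp_path_le hc ω

/-- Integration by parts turns the factor `ω k` into a derivative along `v k`; the chain rule yields
`c k`, and differentiating `G' exp G` yields `(G₂ + G'²) exp G`. -/
lemma integral_eval_mul_exp_path (h : HasBddDeriv₂ G G' G₂ K) {c : ι → ℝ} (hc : ∀ k, |c k| ≤ 1)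
    (k : ι) :
    ∫ ω, ω k * (G' (∑ k, (ω k * c k) • v k) (v k) * Real.exp (G (∑ k, (ω k * c k) • v k)))
        ∂(gaussianPi ι) =
      ∫ ω, c k * ((G₂ (∑ k, (ω k * c k) • v k) (v k) + G' (∑ k, (ω k * c k) • v k) (v k) ^ 2) *
        Real.exp (G (∑ k, (ω k * c k) • v k))) ∂(gaussianPi ι) := by
  classical
  have hp := continuous_path v c
  have hE : Continuous fun ω : ι → ℝ => Real.exp (G (∑ k, (ω k * c k) • v k)) :=
    Real.continuous_exp.comp (h.continuous.comp hp)
  have h1 := (h.continuous₁ (v k)).comp hp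
  have h2 := (h.continuous₂ (v k)).comp hp
  simp only [Function.comp_def] at h1 h2
  refine integral_eval_mul_gaussianPi k (fun ω => ?_) ?_ ?_ ?_
  · set x := ∑ k, (ω k * c k) • v k with hx
    -- Changing coordinate `k` moves the path point along the line through `x` in direction `v k`,
    -- where `G₂` is the derivative of `G'`.
    have hu : ∀ t, ∑ j, (Function.update ω k t j * c j) • v j = x + ((t - ω k) * c k) • v k := by
      intro t
      rw [hx, ← Finset.sum_erase_add _ _ (Finset.mem_univ k),
        ← Finset.sum_erase_add (a := k) Finset.univ (fun j => (ω j * c j) • v j) (Finset.mem_univ k),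
        Function.update_self, add_assoc, ← add_smul]
      congr 1
      · refine Finset.sum_congr rfl fun i hi => ?_
        rw [Function.update_of_ne (Finset.ne_of_mem_erase hi)]
      · congr 1; ring
    simp only [hu]
    have hl : HasDerivAt (fun t : ℝ => (t - ω k) * c k) (c k) (ω k) := by
      simpa using ((hasDerivAt_id (ω k)).sub_const (ω k)).mul_const (c k)
    have d1 : HasDerivAt (fun t : ℝ => G' (x + ((t - ω k) * c k) • v k) (v k))
        (G₂ x (v k) * c k) (ω k) := by
      have := h.hasDerivAt x (v k)
      have h0 : (ω k - ω k) * c k = 0 := by simp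
      rw [← h0] at this
      exact this.comp (ω k) hl
    have d2 : HasDerivAt (fun t : ℝ => Real.exp (G (x + ((t - ω k) * c k) • v k)))
        (Real.exp (G x) * (G' x (v k) * c k)) (ω k) := by
      have := (h.hasDerivAt_line x (v k) ((ω k - ω k) * c k)).comp (ω k) hl
      simpa using this.exp
    refine (d1.mul d2).congr_deriv ?_
    simp only [sub_self, zero_mul, zero_smul, add_zero]
    ring
  · refine integrable_of_le_exp_sum_abs (h1.mul hE).aestronglyMeasurable
      (K * ‖v k‖ * Real.exp (G 0)) (K * (∑ k, ‖v k‖)) fun ω => ?_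
    rw [abs_mul, abs_of_pos (Real.exp_pos _), mul_assoc]
    have := h.nonneg
    gcongr
    exacts [h.abs_le _ _, h.exp_path_le hc ω]
  · exact h.integrable_eval_mul_exp_path hc k
  · exact (h.integrable_deriv₂_exp_path hc k).const_mul _

/-- Differentiating under the integral produces `∑ ω k c'ₖ G'(v k) exp G`, and integration by parts
removes each `ω k`. Only second order terms along the `v k` remain, with weights `c'ₖ cₖ`. -/
lemma hasDerivAt_integral_exp_path (h : HasBddDeriv₂ G G' G₂ K)
    (hd : ∀ k θ, HasDerivAt (c k) (c' k θ) θ)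
    (hc : ∀ k θ, |c k θ| ≤ 1) (hc' : ∀ k θ, |c' k θ| ≤ 1) (θ : ℝ) :
    HasDerivAt (fun θ => ∫ ω, Real.exp (G (∑ k, (ω k * c k θ) • v k)) ∂(gaussianPi ι))
      (∑ k, c' k θ * c k θ * ∫ ω, (G₂ (∑ k, (ω k * c k θ) • v k) (v k) +
        G' (∑ k, (ω k * c k θ) • v k) (v k) ^ 2) *
        Real.exp (G (∑ k, (ω k * c k θ) • v k)) ∂(gaussianPi ι)) θ := by
  have hm : ∀ θ, AEStronglyMeasurable
      (fun ω => Real.exp (G (∑ k, (ω k * c k θ) • v k))) (gaussianPi ι) := fun θ =>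
    (Real.continuous_exp.comp (h.continuous.comp (continuous_path v _))).aestronglyMeasurable
  have hlin : ∀ (ω : ι → ℝ) θ, G' (∑ k, (ω k * c k θ) • v k) (∑ k, (ω k * c' k θ) • v k) =
      ∑ k, ω k * c' k θ * G' (∑ k, (ω k * c k θ) • v k) (v k) := by
    intro ω θ
    simp only [map_sum, map_smul, smul_eq_mul]
  have hcont : Continuous fun ω : ι → ℝ => Real.exp (G (∑ k, (ω k * c k θ) • v k)) *
      G' (∑ k, (ω k * c k θ) • v k) (∑ k, (ω k * c' k θ) • v k) := by
    simp only [hlin]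
    refine (Real.continuous_exp.comp (h.continuous.comp (continuous_path v _))).mul ?_
    refine continuous_finsetSum _ fun k _ => ?_
    exact Continuous.mul (by fun_prop) ((h.continuous₁ (v k)).comp (continuous_path v _))
  have key := hasDerivAt_integral_of_dominated_loc_of_deriv_le (μ := gaussianPi ι) (x₀ := θ)
    (F := fun θ ω => Real.exp (G (∑ k, (ω k * c k θ) • v k)))
    (F' := fun θ ω => Real.exp (G (∑ k, (ω k * c k θ) • v k)) *
      G' (∑ k, (ω k * c k θ) • v k) (∑ k, (ω k * c' k θ) • v k))
    -- The `+ 1` in the exponent absorbs the linear factor `∑ |ω k|` coming from the velocity of the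
    -- path.
    (bound := fun ω => Real.exp (G 0) * K * (∑ k, ‖v k‖) *
      Real.exp ((K * (∑ k, ‖v k‖) + 1) * ∑ k, |ω k|)) (s := Set.univ) Filter.univ_mem
    (Filter.Eventually.of_forall hm) (h.integrable_exp_path fun k => hc k θ)
    hcont.aestronglyMeasurable (ae_of_all _ fun ω θ _ => ?_)
    ((integrable_exp_mul_sum_abs _).const_mul _) (ae_of_all _ fun ω θ _ => ?_)
  · refine key.2.congr_deriv ?_
    have e : ∀ ω : ι → ℝ, Real.exp (G (∑ k, (ω k * c k θ) • v k)) *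
        G' (∑ k, (ω k * c k θ) • v k) (∑ k, (ω k * c' k θ) • v k) =
        ∑ k, c' k θ * (ω k * (G' (∑ k, (ω k * c k θ) • v k) (v k) *
          Real.exp (G (∑ k, (ω k * c k θ) • v k)))) := by
      intro ω
      rw [hlin, Finset.mul_sum]
      refine Finset.sum_congr rfl fun k _ => by ring
    simp only [e]
    rw [integral_finsetSum]
    · refine Finset.sum_congr rfl fun k _ => ?_
      rw [integral_const_mul, h.integral_eval_mul_exp_path (fun k => hc k θ), integral_const_mul,
        mul_assoc]
    · intro k _
      exact (h.integrable_eval_mul_exp_path (fun k => hc k θ) k).const_mul _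
  · rw [Real.norm_eq_abs, abs_mul, abs_of_pos (Real.exp_pos _), add_mul, Real.exp_add]
    have hK := h.nonneg
    have e1 : ∑ i, |ω i| ≤ Real.exp (1 * ∑ i, |ω i|) := by
      linarith [Real.add_one_le_exp (1 * ∑ i, |ω i|)]
    calc _ ≤ (Real.exp (G 0) * Real.exp (K * (∑ k, ‖v k‖) * ∑ k, |ω k|)) *
          (K * ((∑ k, ‖v k‖) * Real.exp (1 * ∑ i, |ω i|))) := by
          gcongr
          · exact h.exp_path_le (fun k => hc k θ) ω
          · refine (h.abs_le _ _).trans ?_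
            gcongr
            refine (norm_sum_smul_le v (fun k => hc' k θ) ω).trans ?_
            gcongr
      _ = _ := by ring
  · have hZ : HasDerivAt (fun θ => ∑ k, (ω k * c k θ) • v k) (∑ k, (ω k * c' k θ) • v k) θ :=
      HasDerivAt.fun_sum fun k _ => ((hd k θ).const_mul (ω k)).smul_const (v k)
    exact ((h.hasFDerivAt _).comp_hasDerivAt θ hZ).exp

end Path

lemma continuous_exp_sum (h : HasBddDeriv₂ G G' G₂ K) {ι : Type*} [Fintype ι] (u : ι → E) :
    Continuous fun ω : ι → ℝ => Real.exp (G (∑ i, ω i • u i)) :=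
  Real.continuous_exp.comp (h.continuous.comp (by fun_prop))

lemma gaussianPi_map_inl (ι κ : Type*) [Fintype ι] [Fintype κ] :
    MeasurePreserving (fun (ω : ι ⊕ κ → ℝ) i => ω (Sum.inl i)) (gaussianPi (ι ⊕ κ))
      (gaussianPi ι) :=
  measurePreserving_fst.comp
    (measurePreserving_sumPiEquivProdPi (fun _ : ι ⊕ κ => gaussianReal 0 1))

lemma gaussianPi_map_inr (ι κ : Type*) [Fintype ι] [Fintype κ] :
    MeasurePreserving (fun (ω : ι ⊕ κ → ℝ) i => ω (Sum.inr i)) (gaussianPi (ι ⊕ κ))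
      (gaussianPi κ) :=
  measurePreserving_snd.comp
    (measurePreserving_sumPiEquivProdPi (fun _ : ι ⊕ κ => gaussianReal 0 1))

/-- Gaussian comparison: if the second order operators of the covariances of two centred Gaussian
vectors are ordered on `exp ∘ G`, then so are the expectations of `exp ∘ G`. -/
theorem integral_exp_le_integral_exp (h : HasBddDeriv₂ G G' G₂ K) {ι κ : Type*} [Fintype ι]
    [Fintype κ] (a : ι → E) (b : κ → E)
    (hab : ∀ x, ∑ i, (G₂ x (a i) + G' x (a i) ^ 2) ≤ ∑ j, (G₂ x (b j) + G' x (b j) ^ 2)) :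
    ∫ ω, Real.exp (G (∑ i, ω i • a i)) ∂(gaussianPi ι) ≤
      ∫ ω, Real.exp (G (∑ j, ω j • b j)) ∂(gaussianPi κ) := by
  -- Rotate from the first Gaussian vector to the second: `cos θ ∑ ωᵢ aᵢ + sin θ ∑ ωⱼ bⱼ`. The
  -- weights `c' c` are then `∓ sin θ cos θ`, so on `[0, π/2]` the derivative has the sign of the
  -- difference of the two operators.
  let v : ι ⊕ κ → E := Sum.elim a b
  let c : ι ⊕ κ → ℝ → ℝ := Sum.elim (fun _ => Real.cos) (fun _ => Real.sin)
  let c' : ι ⊕ κ → ℝ → ℝ := Sum.elim (fun _ θ => -Real.sin θ) (fun _ => Real.cos)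
  have hd : ∀ k θ, HasDerivAt (c k) (c' k θ) θ := by
    rintro (k | k) θ
    exacts [Real.hasDerivAt_cos θ, Real.hasDerivAt_sin θ]
  have hc : ∀ k θ, |c k θ| ≤ 1 := by
    rintro (k | k) θ
    exacts [Real.abs_cos_le_one θ, Real.abs_sin_le_one θ]
  have hc' : ∀ k θ, |c' k θ| ≤ 1 := by
    rintro (k | k) θ
    exacts [(abs_neg _).trans_le (Real.abs_sin_le_one θ), Real.abs_cos_le_one θ]
  have key := h.hasDerivAt_integral_exp_path (v := v) hd hc hc'
  have hint : ∀ θ k, Integrable (fun ω => (G₂ (∑ k, (ω k * c k θ) • v k) (v k) +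
        G' (∑ k, (ω k * c k θ) • v k) (v k) ^ 2) *
        Real.exp (G (∑ k, (ω k * c k θ) • v k))) (gaussianPi (ι ⊕ κ)) := fun θ k =>
    h.integrable_deriv₂_exp_path (fun k => hc k θ) k
  have hmono : MonotoneOn (fun θ => ∫ ω, Real.exp (G (∑ k, (ω k * c k θ) • v k))
      ∂(gaussianPi (ι ⊕ κ))) (Set.Icc 0 (Real.pi / 2)) := by
    refine monotoneOn_of_deriv_nonneg (convex_Icc _ _)
      (fun θ _ => (key θ).continuousAt.continuousWithinAt)
      (fun θ _ => (key θ).differentiableAt.differentiableWithinAt) fun θ hθ => ?_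
    rw [interior_Icc] at hθ
    have hs : 0 ≤ Real.sin θ * Real.cos θ := mul_nonneg
      (Real.sin_nonneg_of_nonneg_of_le_pi hθ.1.le (by linarith [hθ.2, Real.pi_pos]))
      (Real.cos_nonneg_of_neg_pi_div_two_le_of_le (by linarith [hθ.1, Real.pi_pos]) hθ.2.le)
    rw [(key θ).deriv, Fintype.sum_sum_type]
    have e1 : ∀ i, c' (Sum.inl i) θ * c (Sum.inl i) θ = -(Real.sin θ * Real.cos θ) := fun i => by
      simp [c, c']
    have e2 : ∀ i, c' (Sum.inr i) θ * c (Sum.inr i) θ = Real.sin θ * Real.cos θ := fun i => by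
      simp [c, c', mul_comm]
    simp only [e1, e2]
    rw [← Finset.mul_sum, ← Finset.mul_sum, neg_mul, neg_add_eq_sub, ← mul_sub,
      ← integral_finsetSum _ fun k _ => hint θ _, ← integral_finsetSum _ fun k _ => hint θ _,
      ← integral_sub (integrable_finsetSum _ fun k _ => hint θ _)
        (integrable_finsetSum _ fun k _ => hint θ _)]
    refine mul_nonneg hs (integral_nonneg fun ω => ?_)
    simp only [Pi.zero_apply]
    rw [← Finset.sum_mul, ← Finset.sum_mul, ← sub_mul]
    exact mul_nonneg (sub_nonneg.2 (hab _)) (Real.exp_pos _).le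
  have := hmono (Set.left_mem_Icc.2 (by positivity)) (Set.right_mem_Icc.2 (by positivity))
    (by positivity)
  simp only [Fintype.sum_sum_type, c, v, Sum.elim_inl, Sum.elim_inr, Real.cos_zero, Real.sin_zero,
    Real.cos_pi_div_two, Real.sin_pi_div_two, mul_one, mul_zero, zero_smul,
    Finset.sum_const_zero, add_zero, zero_add] at this
  have l := gaussianPi_map_inl ι κ
  have r := gaussianPi_map_inr ι κ
  rw [← l.map_eq, ← r.map_eq, integral_map l.aemeasurable, integral_map r.aemeasurable]
  · exact this
  · exact (h.continuous_exp_sum b).aestronglyMeasurable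
  · exact (h.continuous_exp_sum a).aestronglyMeasurable

end HasBddDeriv₂

/-! ### Stability of bounded second order differentiability. -/

namespace HasBddDeriv₂

variable {E : Type*} [NormedAddCommGroup E] [NormedSpace ℝ E]
  {E₂ : Type*} [NormedAddCommGroup E₂] [NormedSpace ℝ E₂]
  {G : E → ℝ} {G' : E → E →L[ℝ] ℝ} {G₂ : E → E → ℝ} {K : ℝ}

lemma comp_clm (h : HasBddDeriv₂ G G' G₂ K) (L : E₂ →L[ℝ] E) :
    HasBddDeriv₂ (fun x => G (L x)) (fun x => (G' (L x)).comp L) (fun x v => G₂ (L x) (L v))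
      (K * ‖L‖ + K * ‖L‖ ^ 2) where
  hasFDerivAt x := (h.hasFDerivAt (L x)).comp x L.hasFDerivAt
  hasDerivAt x v := by simpa using h.hasDerivAt (L x) (L v)
  abs_le x v := by
    have := h.nonneg
    calc _ ≤ K * ‖L v‖ := h.abs_le _ _
      _ ≤ K * (‖L‖ * ‖v‖) := by gcongr; exact L.le_opNorm v
      _ ≤ _ := by nlinarith [show 0 ≤ K * ‖L‖ ^ 2 * ‖v‖ by positivity]
  abs_le₂ x v := by
    have := h.nonneg
    calc _ ≤ K * ‖L v‖ ^ 2 := h.abs_le₂ _ _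
      _ ≤ K * (‖L‖ * ‖v‖) ^ 2 := by gcongr; exact L.le_opNorm v
      _ ≤ _ := by nlinarith [show 0 ≤ K * ‖L‖ * ‖v‖ ^ 2 by positivity]
  continuous₁ v := (h.continuous₁ (L v)).comp L.continuous
  continuous₂ v := (h.continuous₂ (L v)).comp L.continuous
  nonneg := by have := h.nonneg; positivity

lemma add {F : E → ℝ} {F' : E → E →L[ℝ] ℝ} {F₂ : E → E → ℝ} {C : ℝ} (h : HasBddDeriv₂ G G' G₂ K)
    (hF : HasBddDeriv₂ F F' F₂ C) :
    HasBddDeriv₂ (fun x => G x + F x) (fun x => G' x + F' x) (fun x v => G₂ x v + F₂ x v)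
      (K + C) where
  hasFDerivAt x := (h.hasFDerivAt x).add (hF.hasFDerivAt x)
  hasDerivAt x v := (h.hasDerivAt x v).add (hF.hasDerivAt x v)
  abs_le x v := by
    rw [add_mul]; exact (abs_add_le _ _).trans (add_le_add (h.abs_le x v) (hF.abs_le x v))
  abs_le₂ x v := by
    rw [add_mul]; exact (abs_add_le _ _).trans (add_le_add (h.abs_le₂ x v) (hF.abs_le₂ x v))
  continuous₁ v := (h.continuous₁ v).add (hF.continuous₁ v)
  continuous₂ v := (h.continuous₂ v).add (hF.continuous₂ v)
  nonneg := add_nonneg h.nonneg hF.nonneg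

lemma const_mul (h : HasBddDeriv₂ G G' G₂ K) (c : ℝ) :
    HasBddDeriv₂ (fun x => c * G x) (fun x => c • G' x) (fun x v => c * G₂ x v) (|c| * K) where
  hasFDerivAt x := (h.hasFDerivAt x).const_mul c
  hasDerivAt x v := (h.hasDerivAt x v).const_mul c
  abs_le x v := by
    rw [mul_assoc, _root_.smul_apply, smul_eq_mul, abs_mul]
    exact mul_le_mul_of_nonneg_left (h.abs_le x v) (abs_nonneg c)
  abs_le₂ x v := by
    rw [mul_assoc, abs_mul]; exact mul_le_mul_of_nonneg_left (h.abs_le₂ x v) (abs_nonneg c)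
  continuous₁ v := (h.continuous₁ v).const_smul c
  continuous₂ v := (h.continuous₂ v).const_smul c
  nonneg := mul_nonneg (abs_nonneg c) h.nonneg

lemma of_clm_add_const (L : E →L[ℝ] ℝ) (c : ℝ) :
    HasBddDeriv₂ (fun x => L x + c) (fun _ => L) (fun _ _ => 0) ‖L‖ where
  hasFDerivAt x := L.hasFDerivAt.add_const c
  hasDerivAt x v := hasDerivAt_const _ _
  abs_le x v := L.le_opNorm v
  abs_le₂ x v := by rw [abs_zero]; positivity
  continuous₁ v := continuous_const
  continuous₂ v := continuous_const
  nonneg := norm_nonneg _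

lemma mono (h : HasBddDeriv₂ G G' G₂ K) {C : ℝ} (hC : K ≤ C) : HasBddDeriv₂ G G' G₂ C where
  hasFDerivAt := h.hasFDerivAt
  hasDerivAt := h.hasDerivAt
  abs_le x v := (h.abs_le x v).trans (by gcongr)
  abs_le₂ x v := (h.abs_le₂ x v).trans (by gcongr)
  continuous₁ := h.continuous₁
  continuous₂ := h.continuous₂
  nonneg := h.nonneg.trans hC

end HasBddDeriv₂

/-! ### A smooth norm. -/

section SmoothNorm

variable {H : Type*} [NormedAddCommGroup H]

/-- A smooth approximation of the norm. -/
noncomputable def smoothNorm (ε : ℝ) (x : H) : ℝ := √(‖x‖ ^ 2 + ε ^ 2)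

lemma smoothNorm_pos {ε : ℝ} (hε : 0 < ε) (x : H) : 0 < smoothNorm ε x :=
  Real.sqrt_pos.2 (by positivity)

lemma norm_le_smoothNorm (ε : ℝ) (x : H) : ‖x‖ ≤ smoothNorm ε x :=
  Real.le_sqrt_of_sq_le (by nlinarith [sq_nonneg ε])

lemma smoothNorm_le {ε : ℝ} (hε : 0 < ε) (x : H) : smoothNorm ε x ≤ ‖x‖ + ε :=
  Real.sqrt_le_iff.2 ⟨by positivity, by nlinarith [norm_nonneg x]⟩

lemma le_smoothNorm (ε : ℝ) (x : H) : ε ≤ smoothNorm ε x :=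
  Real.le_sqrt_of_sq_le (by nlinarith [sq_nonneg ‖x‖])

lemma hasBddDeriv₂_smoothNorm [InnerProductSpace ℝ H] {ε : ℝ} (hε : 0 < ε) :
    HasBddDeriv₂ (smoothNorm ε : H → ℝ) (fun x => (smoothNorm ε x)⁻¹ • innerSL ℝ x)
      (fun x v => ‖v‖ ^ 2 / smoothNorm ε x - inner ℝ x v ^ 2 / smoothNorm ε x ^ 3)
      (1 + 2 / ε) where
  hasFDerivAt x := by
    have h1 := ((hasStrictFDerivAt_norm_sq x).hasFDerivAt.add_const (ε ^ 2)).sqrt (by positivity)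
    refine h1.congr_fderiv ?_
    ext v
    simp [smoothNorm]
    field_simp
  hasDerivAt x v := by
    have hp := smoothNorm_pos hε x
    have hl : HasDerivAt (fun t : ℝ => x + t • v) v 0 := by
      simpa using ((hasDerivAt_id (0 : ℝ)).smul_const v).const_add x
    have h0 : HasDerivAt (fun t : ℝ => smoothNorm ε (x + t • v))
        ((smoothNorm ε x)⁻¹ * inner ℝ x v) 0 := by
      have h1 := ((hl.norm_sq).add_const (ε ^ 2)).sqrt (by positivity)
      refine h1.congr_deriv ?_
      simp [smoothNorm]
      field_simp
    have h2 : HasDerivAt (fun t : ℝ => (inner ℝ (x + t • v) v : ℝ)) (‖v‖ ^ 2) 0 := by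
      have := hl.inner ℝ (hasDerivAt_const (0 : ℝ) v)
      simpa using this
    have h3 := (h0.fun_inv (by simpa using hp.ne')).mul h2
    refine h3.congr_deriv ?_
    simp only [zero_smul, add_zero]
    field_simp
    ring
  abs_le x v := by
    have hp := smoothNorm_pos hε x
    simp only [_root_.smul_apply, innerSL_apply_apply, smul_eq_mul]
    rw [abs_mul, abs_of_pos (inv_pos.2 hp), inv_mul_le_iff₀ hp]
    calc |inner ℝ x v| ≤ ‖x‖ * ‖v‖ := abs_real_inner_le_norm _ _
      _ ≤ smoothNorm ε x * ‖v‖ := by gcongr; exact norm_le_smoothNorm ε x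
      _ ≤ smoothNorm ε x * ((1 + 2 / ε) * ‖v‖) := by
        gcongr
        exact le_mul_of_one_le_left (norm_nonneg _) (by have : 0 < 2 / ε := by positivity
                                                        linarith)
  abs_le₂ x v := by
    have hp := smoothNorm_pos hε x
    have h1 : ‖v‖ ^ 2 / smoothNorm ε x ≤ ‖v‖ ^ 2 / ε := by
      gcongr; exact le_smoothNorm ε x
    have h2 : inner ℝ x v ^ 2 / smoothNorm ε x ^ 3 ≤ ‖v‖ ^ 2 / smoothNorm ε x := by
      rw [div_le_div_iff₀ (by positivity) hp]
      have : inner ℝ x v ^ 2 ≤ (smoothNorm ε x * ‖v‖) ^ 2 := by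
        rw [sq_le_sq]
        refine (abs_real_inner_le_norm x v).trans ((?_ : _ ≤ _).trans (le_abs_self _))
        gcongr; exact norm_le_smoothNorm ε x
      calc _ ≤ (smoothNorm ε x * ‖v‖) ^ 2 * smoothNorm ε x := by gcongr
        _ = _ := by ring
    have h3 : 0 ≤ inner ℝ x v ^ 2 / smoothNorm ε x ^ 3 := by positivity
    have h4 : 0 ≤ ‖v‖ ^ 2 / smoothNorm ε x := by positivity
    have h5 : (1 + 2 / ε) * ‖v‖ ^ 2 = ‖v‖ ^ 2 + ‖v‖ ^ 2 / ε + ‖v‖ ^ 2 / ε := by ring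
    rw [abs_le, h5]
    constructor <;> nlinarith [sq_nonneg ‖v‖]
  continuous₁ v := by
    simp only [_root_.smul_apply, innerSL_apply_apply, smul_eq_mul]
    have hc : Continuous (smoothNorm ε : H → ℝ) := by unfold smoothNorm; fun_prop
    exact (hc.inv₀ fun x => (smoothNorm_pos hε x).ne').mul (by fun_prop)
  continuous₂ v := by
    have hc : Continuous (smoothNorm ε : H → ℝ) := by unfold smoothNorm; fun_prop
    refine (Continuous.div (by fun_prop) hc fun x => (smoothNorm_pos hε x).ne').sub
      (Continuous.div (by fun_prop) (hc.pow 3) fun x => (pow_pos (smoothNorm_pos hε x) 3).ne')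
  nonneg := by positivity

end SmoothNorm

/-! ### A smooth maximum. -/

section SoftMax

variable {E : Type*} {Z : Type*} [Fintype Z]

/-- The Gibbs weights of the softmax of the functions `a z`. -/
noncomputable def gibbsWeight (β : ℝ) (a : Z → E → ℝ) (x : E) (z : Z) : ℝ :=
  Real.exp (β * a z x) / ∑ y, Real.exp (β * a y x)

/-- A smooth approximation of the maximum of the functions `a z`. -/
noncomputable def softMax (β : ℝ) (a : Z → E → ℝ) (x : E) : ℝ :=
  β⁻¹ * Real.log (∑ z, Real.exp (β * a z x))

variable [Nonempty Z] {β : ℝ} {a : Z → E → ℝ}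

lemma sum_exp_pos (β : ℝ) (a : Z → E → ℝ) (x : E) : 0 < ∑ y, Real.exp (β * a y x) :=
  Finset.sum_pos (fun _ _ => Real.exp_pos _) Finset.univ_nonempty

lemma gibbsWeight_nonneg (β : ℝ) (a : Z → E → ℝ) (x : E) (z : Z) : 0 ≤ gibbsWeight β a x z :=
  div_nonneg (Real.exp_pos _).le (sum_exp_pos β a x).le

lemma sum_gibbsWeight (β : ℝ) (a : Z → E → ℝ) (x : E) : ∑ z, gibbsWeight β a x z = 1 := by
  simp only [gibbsWeight]
  rw [← Finset.sum_div, div_self (sum_exp_pos β a x).ne']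

lemma le_softMax (hβ : 0 < β) (a : Z → E → ℝ) (x : E) (z : Z) : a z x ≤ softMax β a x := by
  rw [softMax, inv_mul_eq_div, le_div_iff₀ hβ, Real.le_log_iff_exp_le (sum_exp_pos β a x), mul_comm]
  exact Finset.single_le_sum (f := fun z => Real.exp (β * a z x)) (fun _ _ => (Real.exp_pos _).le)
    (Finset.mem_univ z)

lemma softMax_le (hβ : 0 < β) (a : Z → E → ℝ) (x : E) {c : ℝ} (hc : ∀ z, a z x ≤ c) :
    softMax β a x ≤ c + Real.log (Fintype.card Z) / β := by
  have h : ∑ z, Real.exp (β * a z x) ≤ Fintype.card Z * Real.exp (β * c) := by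
    rw [← nsmul_eq_mul]
    exact Finset.sum_le_card_nsmul _ _ _ fun z _ => by gcongr; exact hc z
  have hN : (0 : ℝ) < Fintype.card Z := by exact_mod_cast Fintype.card_pos
  rw [softMax, inv_mul_eq_div, div_le_iff₀ hβ, add_mul, div_mul_cancel₀ _ hβ.ne']
  refine (Real.log_le_log (sum_exp_pos β a x) h).trans_eq ?_
  rw [Real.log_mul hN.ne' (Real.exp_pos _).ne', Real.log_exp]
  ring

lemma abs_sum_gibbsWeight_mul_le (β : ℝ) (a : Z → E → ℝ) (x : E) {u : Z → ℝ} {c : ℝ}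
    (hu : ∀ z, |u z| ≤ c) : |∑ z, gibbsWeight β a x z * u z| ≤ c := by
  refine (Finset.abs_sum_le_sum_abs _ _).trans ?_
  calc _ ≤ ∑ z, gibbsWeight β a x z * c := by
        refine Finset.sum_le_sum fun z _ => ?_
        rw [abs_mul, abs_of_nonneg (gibbsWeight_nonneg β a x z)]
        exact mul_le_mul_of_nonneg_left (hu z) (gibbsWeight_nonneg β a x z)
    _ = c := by rw [← Finset.sum_mul, sum_gibbsWeight, one_mul]

/-- The gradient is the Gibbs average of the gradients. The derivative of the weights contributes
`β` times the Gibbs variance of `a' z x v`; its negative half, `-β (mean)²`, is what drives the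
min-max comparison. -/
lemma hasBddDeriv₂_softMax [NormedAddCommGroup E] [NormedSpace ℝ E] (hβ : 0 < β) {a' : Z → E → E →L[ℝ] ℝ} {a₂ : Z → E → E → ℝ} {K : ℝ}
    (h : ∀ z, HasBddDeriv₂ (a z) (a' z) (a₂ z) K) :
    HasBddDeriv₂ (softMax β a) (fun x => ∑ z, gibbsWeight β a x z • a' z x)
      (fun x v => (∑ z, gibbsWeight β a x z * (β * a' z x v ^ 2 + a₂ z x v)) -
        β * (∑ z, gibbsWeight β a x z * a' z x v) ^ 2) (K + 2 * β * K ^ 2) where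
  hasFDerivAt x := by
    have h1 : ∀ z ∈ Finset.univ, HasFDerivAt (fun x => Real.exp (β * a z x))
        (Real.exp (β * a z x) • β • a' z x) x := fun z _ =>
      (((h z).hasFDerivAt x).const_mul β).exp
    have h2 := ((HasFDerivAt.fun_sum h1).log (sum_exp_pos β a x).ne').const_mul β⁻¹
    refine h2.congr_fderiv ?_
    ext v
    simp only [_root_.smul_apply, _root_.sum_apply, smul_eq_mul,
      Finset.mul_sum, gibbsWeight]
    refine Finset.sum_congr rfl fun z _ => ?_
    have := (sum_exp_pos β a x).ne'
    field_simp
  hasDerivAt x v := by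
    have he : ∀ z, HasDerivAt (fun t : ℝ => Real.exp (β * a z (x + t • v)))
        (Real.exp (β * a z x) * (β * a' z x v)) 0 := fun z => by
      have := (((h z).hasDerivAt_line x v 0).const_mul β).exp
      simpa using this
    have hS : HasDerivAt (fun t : ℝ => ∑ z, Real.exp (β * a z (x + t • v)))
        (∑ z, Real.exp (β * a z x) * (β * a' z x v)) 0 :=
      HasDerivAt.fun_sum fun z _ => he z
    have hN : HasDerivAt (fun t : ℝ => ∑ z, Real.exp (β * a z (x + t • v)) * a' z (x + t • v) v)
        (∑ z, (Real.exp (β * a z x) * (β * a' z x v) * a' z x v +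
          Real.exp (β * a z x) * a₂ z x v)) 0 := by
      refine HasDerivAt.fun_sum fun z _ => ?_
      have := (he z).fun_mul ((h z).hasDerivAt x v)
      simpa using this
    have hpos := (sum_exp_pos β a x).ne'
    have hq := hN.div hS (by simpa using hpos)
    have hfun : (fun t : ℝ => (∑ z, gibbsWeight β a (x + t • v) z • a' z (x + t • v)) v) =
        fun t : ℝ => (∑ z, Real.exp (β * a z (x + t • v)) * a' z (x + t • v) v) /
          ∑ z, Real.exp (β * a z (x + t • v)) := by
      ext t
      simp only [_root_.smul_apply, _root_.sum_apply, smul_eq_mul,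
        gibbsWeight, Finset.sum_div]
      refine Finset.sum_congr rfl fun z _ => by ring
    rw [hfun]
    refine hq.congr_deriv ?_
    simp only [zero_smul, add_zero, gibbsWeight]
    have e1 : ∑ z, Real.exp (β * a z x) / (∑ y, Real.exp (β * a y x)) *
        (β * a' z x v ^ 2 + a₂ z x v) = (∑ z, (Real.exp (β * a z x) * (β * a' z x v) * a' z x v +
          Real.exp (β * a z x) * a₂ z x v)) / ∑ y, Real.exp (β * a y x) := by
      rw [Finset.sum_div]; refine Finset.sum_congr rfl fun z _ => by ring
    have e2 : ∑ z, Real.exp (β * a z x) / (∑ y, Real.exp (β * a y x)) * a' z x v =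
        (∑ z, Real.exp (β * a z x) * a' z x v) / ∑ y, Real.exp (β * a y x) := by
      rw [Finset.sum_div]; refine Finset.sum_congr rfl fun z _ => by ring
    have e3 : ∑ z, Real.exp (β * a z x) * (β * a' z x v) =
        β * ∑ z, Real.exp (β * a z x) * a' z x v := by
      rw [Finset.mul_sum]; refine Finset.sum_congr rfl fun z _ => by ring
    rw [e1, e2, e3]
    field_simp
  abs_le x v := by
    have hK := (h (Classical.arbitrary Z)).nonneg
    simp only [_root_.smul_apply, _root_.sum_apply, smul_eq_mul]
    refine (abs_sum_gibbsWeight_mul_le β a x fun z => (h z).abs_le x v).trans ?_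
    gcongr
    nlinarith [mul_nonneg hβ.le (sq_nonneg K)]
  abs_le₂ x v := by
    have hK := (h (Classical.arbitrary Z)).nonneg
    have h1 : |∑ z, gibbsWeight β a x z * (β * a' z x v ^ 2 + a₂ z x v)| ≤
        β * (K * ‖v‖) ^ 2 + K * ‖v‖ ^ 2 := by
      refine abs_sum_gibbsWeight_mul_le β a x fun z => ?_
      refine (abs_add_le _ _).trans (add_le_add ?_ ((h z).abs_le₂ x v))
      rw [abs_mul, abs_pow, abs_of_pos hβ]
      gcongr
      exact (h z).abs_le x v
    have h2 : |β * (∑ z, gibbsWeight β a x z * a' z x v) ^ 2| ≤ β * (K * ‖v‖) ^ 2 := by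
      rw [abs_mul, abs_pow, abs_of_pos hβ]
      gcongr
      exact abs_sum_gibbsWeight_mul_le β a x fun z => (h z).abs_le x v
    refine (abs_sub _ _).trans ((add_le_add h1 h2).trans_eq ?_)
    ring
  continuous₁ v := by
    simp only [_root_.smul_apply, _root_.sum_apply, smul_eq_mul]
    refine continuous_finsetSum _ fun z _ => Continuous.mul ?_ ((h z).continuous₁ v)
    exact Continuous.div (Real.continuous_exp.comp ((h z).continuous.const_mul β))
      (continuous_finsetSum _ fun y _ => Real.continuous_exp.comp ((h y).continuous.const_mul β))
      fun x => (sum_exp_pos β a x).ne'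
  continuous₂ v := by
    have hw : ∀ z, Continuous fun x => gibbsWeight β a x z := fun z =>
      Continuous.div (Real.continuous_exp.comp ((h z).continuous.const_mul β))
        (continuous_finsetSum _ fun y _ =>
          Real.continuous_exp.comp ((h y).continuous.const_mul β))
        fun x => (sum_exp_pos β a x).ne'
    refine Continuous.sub (continuous_finsetSum _ fun z _ => (hw z).mul ?_)
      (Continuous.const_mul (Continuous.pow (continuous_finsetSum _ fun z _ =>
        (hw z).mul ((h z).continuous₁ v)) 2) β)
    exact (((h z).continuous₁ v).pow 2).const_mul β |>.add ((h z).continuous₂ v)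
  nonneg := by
    have hK := (h (Classical.arbitrary Z)).nonneg
    positivity

end SoftMax

/-! ### Gaussian concentration. -/

section Concentration

variable {ι : Type*} [Fintype ι]

lemma sum_smul_single [DecidableEq ι] (ω : ι → ℝ) :
    ∑ i, ω i • EuclideanSpace.single i (1 : ℝ) = WithLp.toLp 2 ω := by
  ext j
  simp [Finset.sum_apply, Pi.single_apply]

lemma measurePreserving_toLp :
    MeasurePreserving (WithLp.toLp 2) (gaussianPi ι) (stdGaussian (EuclideanSpace ℝ ι)) :=
  ⟨by fun_prop, map_pi_eq_stdGaussian⟩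

lemma integral_stdGaussian_eq (f : EuclideanSpace ℝ ι → ℝ) :
    ∫ x, f x ∂(stdGaussian (EuclideanSpace ℝ ι)) = ∫ ω, f (WithLp.toLp 2 ω) ∂(gaussianPi ι) :=
  (measurePreserving_toLp.integral_comp (MeasurableEquiv.toLp 2 (ι → ℝ)).measurableEmbedding f).symm

lemma integrable_stdGaussian_iff (f : EuclideanSpace ℝ ι → ℝ) :
    Integrable f (stdGaussian (EuclideanSpace ℝ ι)) ↔
      Integrable (fun ω => f (WithLp.toLp 2 ω)) (gaussianPi ι) :=
  (measurePreserving_toLp.integrable_comp_emb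
    (MeasurableEquiv.toLp 2 (ι → ℝ)).measurableEmbedding (g := f)).symm

lemma integral_exp_mul_gaussianReal (c : ℝ) :
    ∫ t, Real.exp (c * t) ∂(gaussianReal 0 1) = Real.exp (c ^ 2 / 2) := by
  have := congrFun (mgf_id_gaussianReal (μ := 0) (v := 1)) c
  simpa [mgf] using this

variable {F : EuclideanSpace ℝ ι → ℝ} {F' : EuclideanSpace ℝ ι → EuclideanSpace ℝ ι →L[ℝ] ℝ}
  {F₂ : EuclideanSpace ℝ ι → EuclideanSpace ℝ ι → ℝ} {K : ℝ}

lemma HasBddDeriv₂.integrable_exp (h : HasBddDeriv₂ F F' F₂ K) :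
    Integrable (fun x => Real.exp (F x)) (stdGaussian (EuclideanSpace ℝ ι)) := by
  classical
  rw [integrable_stdGaussian_iff]
  have := h.integrable_exp_path (v := fun i => EuclideanSpace.single i (1 : ℝ))
    (c := fun _ => 1) (by simp)
  simpa only [mul_one, sum_smul_single] using this

lemma HasBddDeriv₂.integrable (h : HasBddDeriv₂ F F' F₂ K) :
    Integrable F (stdGaussian (EuclideanSpace ℝ ι)) := by
  have h1 := h.integrable_exp
  have h2 := (h.const_mul (-1)).integrable_exp
  refine (h1.add h2).mono' h.continuous.aestronglyMeasurable (ae_of_all _ fun x => ?_)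
  simp only [Real.norm_eq_abs, Pi.add_apply, neg_one_mul]
  rw [_root_.abs_le]
  have := Real.add_one_le_exp (F x)
  have := Real.add_one_le_exp (-F x)
  constructor <;> linarith [Real.exp_pos (F x), Real.exp_pos (-F x)]

lemma HasBddDeriv₂.zero_right {E : Type*} [NormedAddCommGroup E] [NormedSpace ℝ E] {G : E → ℝ}
    {G' : E → E →L[ℝ] ℝ} {G₂ : E → E → ℝ} (h : HasBddDeriv₂ G G' G₂ K) (x : E) : G₂ x 0 = 0 := by
  have := h.abs_le₂ x 0
  rw [norm_zero, zero_pow two_ne_zero, mul_zero] at this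
  exact abs_eq_zero.1 (le_antisymm this (abs_nonneg _))

/-- The sum is the squared norm of the vector `v` representing `T`, for which `T v = ‖v‖²`. -/
lemma sum_sq_apply_single_le [DecidableEq ι] (T : EuclideanSpace ℝ ι →L[ℝ] ℝ) {L : ℝ}
    (hT : ∀ v, |T v| ≤ L * ‖v‖) : ∑ i, T (EuclideanSpace.single i 1) ^ 2 ≤ L ^ 2 := by
  set s := ∑ i, T (EuclideanSpace.single i 1) ^ 2 with hs
  have h0 : 0 ≤ s := Finset.sum_nonneg fun _ _ => sq_nonneg _
  let v : EuclideanSpace ℝ ι := WithLp.toLp 2 fun i => T (EuclideanSpace.single i 1)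
  have h1 : T v = s := by
    simp only [v, ← sum_smul_single, map_sum, map_smul, smul_eq_mul, hs, sq]
  have h2 : ‖v‖ ^ 2 = s := by simp [EuclideanSpace.real_norm_sq_eq, v, hs]
  have h3 := hT v
  rw [h1, abs_of_nonneg h0] at h3
  rcases h0.eq_or_lt with h | h
  · rw [← h]; positivity
  · have h4 : s ^ 2 ≤ L ^ 2 * s := by
      calc s ^ 2 ≤ (L * ‖v‖) ^ 2 := by gcongr
        _ = _ := by rw [mul_pow, h2]
    nlinarith

/-- The left side is the moment of `exp (r (F X - F Y))` for independent `X`, `Y`. Compare `(X, Y,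
0)` with `(X, X, √2 L ξ)`, where `F X - F X` cancels and only the Gaussian `ξ` is left. The second
derivatives agree, and the operators are ordered as soon as the gradients at two points have inner
product at most `L²`. -/
lemma HasBddDeriv₂.integral_exp_mul_mul_le (h : HasBddDeriv₂ F F' F₂ K) {L : ℝ}
    (hL : ∀ x v, |F' x v| ≤ L * ‖v‖) (r : ℝ) :
    (∫ x, Real.exp (r * F x) ∂(stdGaussian (EuclideanSpace ℝ ι))) *
      (∫ x, Real.exp (-r * F x) ∂(stdGaussian (EuclideanSpace ℝ ι))) ≤
      Real.exp (r ^ 2 * L ^ 2) := by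
  classical
  let V := EuclideanSpace ℝ ι
  have hG := (((h.comp_clm (ContinuousLinearMap.fst ℝ V (V × ℝ))).const_mul r).add
    ((h.comp_clm ((ContinuousLinearMap.fst ℝ V ℝ).comp
      (ContinuousLinearMap.snd ℝ V (V × ℝ)))).const_mul (-r))).add
    (HasBddDeriv₂.of_clm_add_const (r • (ContinuousLinearMap.snd ℝ V ℝ).comp
      (ContinuousLinearMap.snd ℝ V (V × ℝ))) 0)
  have key := hG.integral_exp_le_integral_exp
    (Sum.elim (fun i : ι => (EuclideanSpace.single i 1, 0, 0))
      (fun i : ι => (0, EuclideanSpace.single i 1, 0)))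
    (Sum.elim (fun i : ι => (EuclideanSpace.single i 1, EuclideanSpace.single i 1, 0))
      (fun _ : Unit => (0, 0, √2 * L))) ?_
  · have e1 : ∀ ω : ι ⊕ ι → ℝ, ∑ i, ω i • (Sum.elim (fun i : ι =>
        ((EuclideanSpace.single i 1, 0, 0) : V × V × ℝ))
        (fun i : ι => (0, EuclideanSpace.single i 1, 0)) i) =
        (WithLp.toLp 2 fun i => ω (Sum.inl i), WithLp.toLp 2 fun i => ω (Sum.inr i), 0) := by
      intro ω
      rw [← sum_smul_single, ← sum_smul_single, Fintype.sum_sum_type]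
      simp [Prod.ext_iff, Prod.fst_sum, Prod.snd_sum]
    have e2 : ∀ ω : ι ⊕ Unit → ℝ, ∑ i, ω i • (Sum.elim (fun i : ι =>
        ((EuclideanSpace.single i 1, EuclideanSpace.single i 1, 0) : V × V × ℝ))
        (fun _ : Unit => (0, 0, √2 * L)) i) =
        (WithLp.toLp 2 fun i => ω (Sum.inl i), WithLp.toLp 2 fun i => ω (Sum.inl i),
          ω (Sum.inr ()) * (√2 * L)) := by
      intro ω
      rw [← sum_smul_single, Fintype.sum_sum_type]
      simp [Prod.ext_iff, Prod.fst_sum, Prod.snd_sum]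
    simp only [e1, e2] at key
    simp only [ContinuousLinearMap.coe_fst', ContinuousLinearMap.comp_apply,
      ContinuousLinearMap.coe_snd', _root_.smul_apply, smul_eq_mul, mul_zero, add_zero] at key
    have l : ∫ ω : ι ⊕ ι → ℝ, Real.exp (r * F (WithLp.toLp 2 fun i => ω (Sum.inl i)) +
        -r * F (WithLp.toLp 2 fun i => ω (Sum.inr i))) ∂(gaussianPi (ι ⊕ ι)) =
        (∫ x, Real.exp (r * F x) ∂(stdGaussian V)) * ∫ x, Real.exp (-r * F x) ∂(stdGaussian V) := by
      rw [integral_stdGaussian_eq, integral_stdGaussian_eq, ← integral_prod_mul,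
        ← (measurePreserving_sumPiEquivProdPi (fun _ : ι ⊕ ι => gaussianReal 0 1)).integral_comp
          (MeasurableEquiv.measurableEmbedding _)]
      refine integral_congr_ae (ae_of_all _ fun ω => ?_)
      simp only [Real.exp_add]
      rfl
    have rr : ∫ ω : ι ⊕ Unit → ℝ, Real.exp (r * F (WithLp.toLp 2 fun i => ω (Sum.inl i)) +
        -r * F (WithLp.toLp 2 fun i => ω (Sum.inl i)) + r * (ω (Sum.inr ()) * (√2 * L)))
        ∂(gaussianPi (ι ⊕ Unit)) = Real.exp (r ^ 2 * L ^ 2) := by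
      have mp := measurePreserving_eval (fun _ : ι ⊕ Unit => gaussianReal 0 1) (Sum.inr ())
      have : ∫ t, Real.exp ((r * (√2 * L)) * t) ∂(gaussianReal 0 1) =
          Real.exp (r ^ 2 * L ^ 2) := by
        rw [integral_exp_mul_gaussianReal]
        congr 1
        rw [mul_pow, mul_pow, Real.sq_sqrt zero_le_two]
        ring
      rw [← this, ← mp.map_eq, integral_map mp.aemeasurable (by fun_prop)]
      refine integral_congr_ae (ae_of_all _ fun ω => ?_)
      simp only [Function.eval]
      congr 1
      ring
    rw [← l, ← rr]
    exact key
  · rintro ⟨x, y, s⟩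
    have hx := sum_sq_apply_single_le (F' x) (hL x)
    have hy := sum_sq_apply_single_le (F' y) (hL y)
    have h2 : (√2 * L) ^ 2 = 2 * L ^ 2 := by rw [mul_pow, Real.sq_sqrt zero_le_two]
    simp only [Fintype.sum_sum_type, Sum.elim_inl, Sum.elim_inr, ContinuousLinearMap.coe_fst',
      ContinuousLinearMap.comp_apply, ContinuousLinearMap.coe_snd', _root_.add_apply,
      _root_.smul_apply, smul_eq_mul, h.zero_right, map_zero, mul_zero, add_zero, zero_add,
      Finset.univ_unique, Finset.sum_singleton]
    have hxy : ∑ i, F' x (EuclideanSpace.single i 1) * F' y (EuclideanSpace.single i 1) ≤ L ^ 2 := by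
      have : ∑ i, F' x (EuclideanSpace.single i 1) * F' y (EuclideanSpace.single i 1) ≤
          ∑ i, (F' x (EuclideanSpace.single i 1) ^ 2 + F' y (EuclideanSpace.single i 1) ^ 2) / 2 :=
        Finset.sum_le_sum fun i _ => by
          nlinarith [sq_nonneg (F' x (EuclideanSpace.single i 1) - F' y (EuclideanSpace.single i 1))]
      rw [← Finset.sum_div, Finset.sum_add_distrib] at this
      linarith
    have e3 : ∑ i, (r * F₂ x (EuclideanSpace.single i 1) + -r * F₂ y (EuclideanSpace.single i 1) +
        (r * F' x (EuclideanSpace.single i 1) + -r * F' y (EuclideanSpace.single i 1)) ^ 2) =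
        ∑ i, (r * F₂ x (EuclideanSpace.single i 1) + (r * F' x (EuclideanSpace.single i 1)) ^ 2) +
        ∑ i, (-r * F₂ y (EuclideanSpace.single i 1) + (-r * F' y (EuclideanSpace.single i 1)) ^ 2) -
        2 * r ^ 2 * ∑ i, F' x (EuclideanSpace.single i 1) * F' y (EuclideanSpace.single i 1) := by
      rw [Finset.mul_sum, ← Finset.sum_add_distrib, ← Finset.sum_sub_distrib]
      refine Finset.sum_congr rfl fun i _ => by ring
    rw [e3, mul_pow r, h2]
    nlinarith [mul_le_mul_of_nonneg_left hxy (sq_nonneg r)]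

/-- Gaussian concentration for smooth Lipschitz functions. -/
lemma HasBddDeriv₂.integral_exp_mul_le (h : HasBddDeriv₂ F F' F₂ K) {L : ℝ}
    (hL : ∀ x v, |F' x v| ≤ L * ‖v‖) (r : ℝ) :
    ∫ x, Real.exp (r * F x) ∂(stdGaussian (EuclideanSpace ℝ ι)) ≤
      Real.exp (r * ∫ x, F x ∂(stdGaussian (EuclideanSpace ℝ ι)) + r ^ 2 * L ^ 2) := by
  have h1 := h.integral_exp_mul_mul_le hL r
  -- Jensen bounds the second factor of the product from below, so it can be divided out to leave
  -- the centred moment of `F`.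
  have h2 : Real.exp (-r * ∫ x, F x ∂(stdGaussian (EuclideanSpace ℝ ι))) ≤
      ∫ x, Real.exp (-r * F x) ∂(stdGaussian (EuclideanSpace ℝ ι)) := by
    rw [← integral_const_mul]
    exact convexOn_exp.map_integral_le Real.continuous_exp.continuousOn isClosed_univ
      (ae_of_all _ fun _ => trivial) (h.integrable.const_mul _) (h.const_mul (-r)).integrable_exp
  have h3 : 0 ≤ ∫ x, Real.exp (r * F x) ∂(stdGaussian (EuclideanSpace ℝ ι)) :=
    integral_nonneg fun _ => (Real.exp_pos _).le
  have h4 := (mul_le_mul_of_nonneg_left h2 h3).trans h1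
  rw [neg_mul, Real.exp_neg, ← div_eq_mul_inv, div_le_iff₀ (Real.exp_pos _)] at h4
  rwa [Real.exp_add, mul_comm]

/-- Gaussian concentration for uniform limits of smooth Lipschitz functions. -/
lemma integral_exp_mul_le_of_approx {f : EuclideanSpace ℝ ι → ℝ} (hf : Continuous f) {L : ℝ}
    (happ : ∀ ε > 0, ∃ F F' F₂ K, HasBddDeriv₂ F F' F₂ K ∧ (∀ x v, |F' x v| ≤ L * ‖v‖) ∧
      ∀ x, |F x - f x| ≤ ε) (r : ℝ) :
    Integrable f (stdGaussian (EuclideanSpace ℝ ι)) ∧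
    Integrable (fun x => Real.exp (r * f x)) (stdGaussian (EuclideanSpace ℝ ι)) ∧
    ∫ x, Real.exp (r * f x) ∂(stdGaussian (EuclideanSpace ℝ ι)) ≤
      Real.exp (r * ∫ x, f x ∂(stdGaussian (EuclideanSpace ℝ ι)) + r ^ 2 * L ^ 2) := by
  have hle : ∀ {F : EuclideanSpace ℝ ι → ℝ} {ε : ℝ}, (∀ x, |F x - f x| ≤ ε) → ∀ x,
      r * f x ≤ r * F x + |r| * ε ∧ r * F x ≤ r * f x + |r| * ε := by
    intro F ε hF x
    have h1 : |r * (F x - f x)| ≤ |r| * ε := by rw [abs_mul]; gcongr; exact hF x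
    rw [abs_le] at h1
    constructor <;> linarith [h1.1, h1.2]
  have hint : Integrable f (stdGaussian (EuclideanSpace ℝ ι)) := by
    obtain ⟨F, F', F₂, K, h, -, hF⟩ := happ 1 one_pos
    refine (h.integrable.norm.add (integrable_const 1)).mono' hf.aestronglyMeasurable
      (ae_of_all _ fun x => ?_)
    simp only [Real.norm_eq_abs, Pi.add_apply]
    have := abs_sub_abs_le_abs_sub (f x) (F x)
    rw [abs_sub_comm] at this
    linarith [hF x]
  have hexp : Integrable (fun x => Real.exp (r * f x)) (stdGaussian (EuclideanSpace ℝ ι)) := by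
    obtain ⟨F, F', F₂, K, h, -, hF⟩ := happ 1 one_pos
    refine ((h.const_mul r).integrable_exp.mul_const (Real.exp (|r| * 1))).mono'
      (by fun_prop) (ae_of_all _ fun x => ?_)
    rw [Real.norm_eq_abs, abs_of_pos (Real.exp_pos _), ← Real.exp_add, Real.exp_le_exp]
    exact (hle hF x).1
  refine ⟨hint, hexp, ?_⟩
  have hlim : Filter.Tendsto (fun ε : ℝ => Real.exp (r * ∫ x, f x ∂(stdGaussian
      (EuclideanSpace ℝ ι)) + r ^ 2 * L ^ 2 + 2 * |r| * ε)) (nhdsWithin 0 (Set.Ioi 0))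
      (nhds (Real.exp (r * ∫ x, f x ∂(stdGaussian (EuclideanSpace ℝ ι)) + r ^ 2 * L ^ 2))) := by
    refine tendsto_nhdsWithin_of_tendsto_nhds ?_
    have : Continuous fun ε : ℝ => Real.exp (r * ∫ x, f x ∂(stdGaussian
      (EuclideanSpace ℝ ι)) + r ^ 2 * L ^ 2 + 2 * |r| * ε) := by fun_prop
    simpa using this.tendsto 0
  refine ge_of_tendsto hlim (Filter.eventually_of_mem self_mem_nhdsWithin fun ε hε => ?_)
  obtain ⟨F, F', F₂, K, h, hL, hF⟩ := happ ε hε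
  calc ∫ x, Real.exp (r * f x) ∂(stdGaussian (EuclideanSpace ℝ ι))
      ≤ ∫ x, Real.exp (r * F x) * Real.exp (|r| * ε) ∂(stdGaussian (EuclideanSpace ℝ ι)) := by
        refine integral_mono hexp ((h.const_mul r).integrable_exp.mul_const _) fun x => ?_
        simp only
        rw [← Real.exp_add, Real.exp_le_exp]
        exact (hle hF x).1
    _ ≤ Real.exp (r * ∫ x, F x ∂(stdGaussian (EuclideanSpace ℝ ι)) + r ^ 2 * L ^ 2) *
        Real.exp (|r| * ε) := by
        rw [integral_mul_const]
        gcongr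
        exact h.integral_exp_mul_le hL r
    _ ≤ _ := by
        rw [← Real.exp_add, Real.exp_le_exp]
        have : r * ∫ x, F x ∂(stdGaussian (EuclideanSpace ℝ ι)) ≤
            r * ∫ x, f x ∂(stdGaussian (EuclideanSpace ℝ ι)) + |r| * ε := by
          rw [← integral_const_mul, ← integral_const_mul]
          have := integral_mono (h.integrable.const_mul r)
            ((hint.const_mul r).add (integrable_const (|r| * ε))) fun x => (hle hF x).2
          rwa [integral_add' (hint.const_mul r) (integrable_const _), integral_const,
            probReal_univ, one_smul] at this
        linarith

/-- Concentration of the norm of a standard Gaussian vector. -/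
lemma integral_exp_mul_norm_le (r : ℝ) :
    Integrable (fun x => ‖x‖) (stdGaussian (EuclideanSpace ℝ ι)) ∧
    Integrable (fun x => Real.exp (r * ‖x‖)) (stdGaussian (EuclideanSpace ℝ ι)) ∧
    ∫ x, Real.exp (r * ‖x‖) ∂(stdGaussian (EuclideanSpace ℝ ι)) ≤
      Real.exp (r * ∫ x, ‖x‖ ∂(stdGaussian (EuclideanSpace ℝ ι)) + r ^ 2) := by
  have := integral_exp_mul_le_of_approx (ι := ι) (f := fun x => ‖x‖) (L := 1) continuous_norm
    (fun ε hε => ⟨_, _, _, _, hasBddDeriv₂_smoothNorm hε, fun x v => ?_, fun x => ?_⟩) r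
  · simpa using this
  · have hp := smoothNorm_pos hε x
    simp only [_root_.smul_apply, innerSL_apply_apply, smul_eq_mul, one_mul]
    rw [abs_mul, abs_of_pos (inv_pos.2 hp), inv_mul_le_iff₀ hp]
    exact (abs_real_inner_le_norm _ _).trans (by gcongr; exact norm_le_smoothNorm ε x)
  · rw [abs_le]
    constructor <;> linarith [norm_le_smoothNorm ε x, smoothNorm_le hε x]

/-- Concentration of the maximum of finitely many linear functions of a standard Gaussian vector. -/
lemma integral_exp_mul_sup_inner_le {Z : Type*} [Fintype Z] [Nonempty Z]
    (u : Z → EuclideanSpace ℝ ι) {L : ℝ} (hu : ∀ z, ‖u z‖ ≤ L) (r : ℝ) :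
    Integrable (fun x => Finset.univ.sup' Finset.univ_nonempty fun z => inner ℝ (u z) x)
      (stdGaussian (EuclideanSpace ℝ ι)) ∧
    Integrable (fun x => Real.exp (r * Finset.univ.sup' Finset.univ_nonempty
      fun z => inner ℝ (u z) x)) (stdGaussian (EuclideanSpace ℝ ι)) ∧
    ∫ x, Real.exp (r * Finset.univ.sup' Finset.univ_nonempty fun z => inner ℝ (u z) x)
      ∂(stdGaussian (EuclideanSpace ℝ ι)) ≤
      Real.exp (r * ∫ x, Finset.univ.sup' Finset.univ_nonempty (fun z => inner ℝ (u z) x)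
        ∂(stdGaussian (EuclideanSpace ℝ ι)) + r ^ 2 * L ^ 2) := by
  have hc : Continuous fun x : EuclideanSpace ℝ ι =>
      Finset.univ.sup' Finset.univ_nonempty fun z => inner ℝ (u z) x :=
    Continuous.finset_sup'_apply _ fun z _ => by fun_prop
  refine integral_exp_mul_le_of_approx hc (fun ε hε => ?_) r
  -- The softmax error is `log |Z| / β`, hence at most `ε`; the `+ 1` keeps `β` positive when `Z`
  -- has one element.
  set β : ℝ := (Real.log (Fintype.card Z) + 1) / ε with hβ'
  have hlog : 0 ≤ Real.log (Fintype.card Z) := Real.log_natCast_nonneg _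
  have hβ : 0 < β := by positivity
  have hL : 0 ≤ L := (norm_nonneg _).trans (hu (Classical.arbitrary Z))
  have ha : ∀ z, HasBddDeriv₂ (fun x => innerSL ℝ (u z) x + 0) (fun _ => innerSL ℝ (u z))
      (fun _ _ => 0) L := fun z =>
    (HasBddDeriv₂.of_clm_add_const (innerSL ℝ (u z)) 0).mono (by simpa using hu z)
  refine ⟨_, _, _, _, hasBddDeriv₂_softMax hβ ha, fun x v => ?_, fun x => ?_⟩
  · simp only [_root_.smul_apply, _root_.sum_apply, smul_eq_mul]
    exact abs_sum_gibbsWeight_mul_le β _ x fun z => (ha z).abs_le x v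
  · have h1 : Finset.univ.sup' Finset.univ_nonempty (fun z => inner ℝ (u z) x) ≤
        softMax β (fun z x => innerSL ℝ (u z) x + 0) x :=
      Finset.sup'_le _ _ fun z _ => by
        simpa using le_softMax hβ (fun z x => innerSL ℝ (u z) x + 0) x z
    have h2 := softMax_le hβ (fun z x => innerSL ℝ (u z) x + 0) x
      (c := Finset.univ.sup' Finset.univ_nonempty (fun z => inner ℝ (u z) x)) fun z => by
        rw [innerSL_apply_apply, add_zero]
        exact Finset.le_sup' (fun z => inner ℝ (u z) x) (Finset.mem_univ z)
    have h3 : Real.log (Fintype.card Z) / β ≤ ε := by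
      rw [div_le_iff₀ hβ, hβ', mul_div_cancel₀ _ hε.ne']
      linarith
    rw [abs_le]
    constructor <;> linarith

end Concentration

/-! ### The covariance inequality and the smoothed min-max comparison. -/

section Gordon

variable {Z ι κ : Type*} [Fintype Z] [Fintype ι] [Fintype κ]

lemma sum_sq_sum_eq (p : Z → ℝ) (f : Z → ι → ℝ) :
    ∑ i, (∑ z, p z * f z i) ^ 2 = ∑ z, ∑ y, p z * p y * ∑ i, f z i * f y i := by
  simp_rw [sq, Finset.sum_mul_sum, Finset.mul_sum]
  rw [Finset.sum_comm]
  refine Finset.sum_congr rfl fun z _ => ?_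
  rw [Finset.sum_comm]
  refine Finset.sum_congr rfl fun y _ => Finset.sum_congr rfl fun i _ => by ring

/-- The covariance inequality behind the comparison theorems of Chevet and Gordon. -/
lemma gordon_covariance_le {p : Z → ℝ} (hp : ∀ z, 0 ≤ p z) (hp1 : ∑ z, p z = 1)
    (q : Z → EuclideanSpace ℝ ι) (hq : ∀ z, ‖q z‖ ≤ 1) (v : Z → EuclideanSpace ℝ κ) :
    ∑ i, (∑ z, p z * (q z i * ‖v z‖)) ^ 2 + ∑ j, (∑ z, p z * v z j) ^ 2 -
      ∑ k : ι × κ, (∑ z, p z * (q z k.1 * v z k.2)) ^ 2 ≤ ∑ z, p z * ‖v z‖ ^ 2 := by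
  have e1 : ∀ z y, ∑ i, q z i * ‖v z‖ * (q y i * ‖v y‖) =
      ‖v z‖ * ‖v y‖ * inner ℝ (q z) (q y) := by
    intro z y
    simp only [PiLp.inner_apply, RCLike.inner_apply, conj_trivial, Finset.mul_sum]
    exact Finset.sum_congr rfl fun i _ => by ring
  have e2 : ∀ z y, ∑ i, v z i * v y i = inner ℝ (v z) (v y) := by
    intro z y
    simp only [PiLp.inner_apply, RCLike.inner_apply, conj_trivial]
    exact Finset.sum_congr rfl fun i _ => by ring
  have e3 : ∀ z y, ∑ k : ι × κ, q z k.1 * v z k.2 * (q y k.1 * v y k.2) =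
      inner ℝ (q z) (q y) * inner ℝ (v z) (v y) := by
    intro z y
    simp only [PiLp.inner_apply, RCLike.inner_apply, conj_trivial, Finset.sum_mul_sum,
      Fintype.sum_prod_type]
    exact Finset.sum_congr rfl fun i _ => Finset.sum_congr rfl fun j _ => by ring
  rw [sum_sq_sum_eq p fun z i => q z i * ‖v z‖, sum_sq_sum_eq p fun z i => v z i,
    sum_sq_sum_eq p fun z (k : ι × κ) => q z k.1 * v z k.2]
  simp only [e1, e2, e3]
  have h1 : ∑ z, ∑ y, p z * p y * (‖v z‖ * ‖v y‖) ≤ ∑ z, p z * ‖v z‖ ^ 2 := by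
    have : ∑ z, ∑ y, p z * p y * (‖v z‖ * ‖v y‖) ≤
        ∑ z, ∑ y, p z * p y * ((‖v z‖ ^ 2 + ‖v y‖ ^ 2) / 2) :=
      Finset.sum_le_sum fun z _ => Finset.sum_le_sum fun y _ =>
        mul_le_mul_of_nonneg_left (by nlinarith [sq_nonneg (‖v z‖ - ‖v y‖)])
          (mul_nonneg (hp z) (hp y))
    refine this.trans_eq ?_
    have e : ∀ z y, p z * p y * ((‖v z‖ ^ 2 + ‖v y‖ ^ 2) / 2) =
        (p z * ‖v z‖ ^ 2) / 2 * p y + p z * ((p y * ‖v y‖ ^ 2) / 2) := fun z y => by ring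
    simp only [e, Finset.sum_add_distrib, ← Finset.mul_sum, hp1, mul_one, ← Finset.sum_mul,
      one_mul]
    rw [← Finset.sum_div]
    ring
  refine le_trans ?_ h1
  simp only [← Finset.sum_add_distrib, ← Finset.sum_sub_distrib]
  refine Finset.sum_le_sum fun z _ => Finset.sum_le_sum fun y _ => ?_
  have h2 : inner ℝ (q z) (q y) ≤ (1 : ℝ) :=
    (real_inner_le_norm _ _).trans (mul_le_one₀ (hq z) (norm_nonneg _) (hq y))
  have h3 := real_inner_le_norm (v z) (v y)
  -- Termwise the claim is `(‖v‖‖v'‖ - ⟨v, v'⟩)(1 - ⟨q, q'⟩) ≥ 0`.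
  have h4 := mul_nonneg (mul_nonneg (hp z) (hp y))
    (mul_nonneg (sub_nonneg.2 h3) (sub_nonneg.2 h2))
  linear_combination h4

/-- The image of a vector under the matrix with entries `ω (i, j)`. -/
noncomputable def matVec (ω : ι × κ → ℝ) (v : EuclideanSpace ℝ κ) : EuclideanSpace ℝ ι :=
  WithLp.toLp 2 fun i => ∑ j, ω (i, j) * v j

variable {σ : ℝ} (c : Z → ℝ) (v : Z → EuclideanSpace ℝ κ)

/-- The functions whose softmax is used in the Gaussian min-max comparison. -/
noncomputable def signedNormAdd (ι : Type*) [Fintype ι] (σ ε : ℝ) (c : Z → ℝ) (z : Z)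
    (x : Z → EuclideanSpace ℝ ι × ℝ) : ℝ :=
  σ * smoothNorm ε (x z).1 + ((x z).2 + c z)

/-- Softmax requires one bound `K` common to all `z`, available because `Z` is finite. -/
lemma exists_hasBddDeriv₂_signedNormAdd (ι : Type*) [Fintype ι] (σ : ℝ) (c : Z → ℝ) {ε : ℝ}
    (hε : 0 < ε) :
    ∃ (A' : Z → (Z → EuclideanSpace ℝ ι × ℝ) → (Z → EuclideanSpace ℝ ι × ℝ) →L[ℝ] ℝ) (K : ℝ),
      (∀ z x w, A' z x w =
        σ * inner ℝ ((smoothNorm ε (x z).1)⁻¹ • (x z).1) (w z).1 + (w z).2) ∧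
      ∀ z, HasBddDeriv₂ (signedNormAdd ι σ ε c z) (A' z)
        (fun x w => σ * (‖(w z).1‖ ^ 2 / smoothNorm ε (x z).1 -
          inner ℝ (x z).1 (w z).1 ^ 2 / smoothNorm ε (x z).1 ^ 3)) K := by
  let P : Z → (Z → EuclideanSpace ℝ ι × ℝ) →L[ℝ] EuclideanSpace ℝ ι × ℝ := fun z => ContinuousLinearMap.proj z
  have ha := fun z => ((((hasBddDeriv₂_smoothNorm (H := EuclideanSpace ℝ ι) hε).comp_clm
    ((ContinuousLinearMap.fst ℝ (EuclideanSpace ℝ ι) ℝ).comp (P z))).const_mul σ).add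
    (HasBddDeriv₂.of_clm_add_const ((ContinuousLinearMap.snd ℝ (EuclideanSpace ℝ ι) ℝ).comp (P z)) (c z)))
  obtain ⟨K, hK⟩ := Finite.exists_le fun z => |σ| * ((1 + 2 / ε) *
    ‖(ContinuousLinearMap.fst ℝ (EuclideanSpace ℝ ι) ℝ).comp (P z)‖ + (1 + 2 / ε) *
    ‖(ContinuousLinearMap.fst ℝ (EuclideanSpace ℝ ι) ℝ).comp (P z)‖ ^ 2) +
    ‖(ContinuousLinearMap.snd ℝ (EuclideanSpace ℝ ι) ℝ).comp (P z)‖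
  refine ⟨fun z x => σ • ((smoothNorm ε ((ContinuousLinearMap.fst ℝ (EuclideanSpace ℝ ι) ℝ ∘SL P z) x))⁻¹ •
      innerSL ℝ ((ContinuousLinearMap.fst ℝ (EuclideanSpace ℝ ι) ℝ ∘SL P z) x)) ∘SL
      ContinuousLinearMap.fst ℝ (EuclideanSpace ℝ ι) ℝ ∘SL P z +
      ContinuousLinearMap.snd ℝ (EuclideanSpace ℝ ι) ℝ ∘SL P z, K, fun z x w => ?_, fun z => ?_⟩
  rotate_left
  · have := (ha z).mono (hK z)
    simp only [add_zero] at this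
    exact this
  · rw [real_inner_smul_left]
    rfl

/-- Compares the process `A v_z` with `‖v_z‖ g` plus the scalar `⟨h, v_z⟩`. Keeping the norm as a
function, instead of a supremum over a sphere, treats `σ = 1` and `σ = -1` together: in first order
terms `σ` enters only squared, and the second derivatives of the norm contribute equally on both
sides. The normalized vector `q = x / smoothNorm` plays the role of the dual variable. -/
lemma integral_exp_softMax_le [Nonempty Z] (hσ : σ ^ 2 = 1) {ε β r : ℝ} (hε : 0 < ε) (hr : 0 ≤ r) (hβ : 0 < β)
    (hrβ : r ≤ β) :
    Integrable (fun ω : ι × κ → ℝ => Real.exp (r * softMax β (signedNormAdd ι σ ε c)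
      fun z => (matVec ω (v z), 0))) (gaussianPi (ι × κ)) ∧
    Integrable (fun ω : ι ⊕ κ → ℝ => Real.exp (r * softMax β (signedNormAdd ι σ ε c)
      fun z => (‖v z‖ • WithLp.toLp 2 fun i => ω (Sum.inl i), ∑ j, ω (Sum.inr j) * v z j)))
      (gaussianPi (ι ⊕ κ)) ∧
    ∫ ω : ι × κ → ℝ, Real.exp (r * softMax β (signedNormAdd ι σ ε c)
      fun z => (matVec ω (v z), 0)) ∂(gaussianPi (ι × κ)) ≤
    ∫ ω : ι ⊕ κ → ℝ, Real.exp (r * softMax β (signedNormAdd ι σ ε c)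
      fun z => (‖v z‖ • WithLp.toLp 2 fun i => ω (Sum.inl i), ∑ j, ω (Sum.inr j) * v z j))
      ∂(gaussianPi (ι ⊕ κ)) := by
  classical
  obtain ⟨A', K, hA', ha⟩ := exists_hasBddDeriv₂_signedNormAdd ι σ c hε
  have hG := (hasBddDeriv₂_softMax hβ ha).const_mul r
  let a : ι × κ → Z → EuclideanSpace ℝ ι × ℝ := fun k z => (v z k.2 • EuclideanSpace.single k.1 1, 0)
  let b : ι ⊕ κ → Z → EuclideanSpace ℝ ι × ℝ := Sum.elim (fun i z => (‖v z‖ • EuclideanSpace.single i 1, 0))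
    (fun j z => (0, v z j))
  have ea : ∀ ω : ι × κ → ℝ, ∑ k, ω k • a k = fun z => (matVec ω (v z), 0) := by
    intro ω
    ext z : 1
    rw [Finset.sum_apply, Prod.ext_iff, Prod.fst_sum, Prod.snd_sum]
    refine ⟨?_, by simp [a]⟩
    simp only [a, Pi.smul_apply, Prod.smul_fst, matVec]
    rw [← sum_smul_single, Fintype.sum_prod_type]
    simp only [Finset.sum_smul, smul_smul]
  have eb : ∀ ω : ι ⊕ κ → ℝ, ∑ k, ω k • b k = fun z =>
      (‖v z‖ • WithLp.toLp 2 fun i => ω (Sum.inl i), ∑ j, ω (Sum.inr j) * v z j) := by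
    intro ω
    ext z : 1
    rw [Finset.sum_apply, Prod.ext_iff, Prod.fst_sum, Prod.snd_sum]
    refine ⟨?_, by simp [b]⟩
    simp only [b, Pi.smul_apply, Prod.smul_fst, Fintype.sum_sum_type, Sum.elim_inl, Sum.elim_inr,
      smul_zero, Finset.sum_const_zero, add_zero]
    rw [← sum_smul_single, Finset.smul_sum]
    simp only [smul_smul, mul_comm]
  have key := hG.integral_exp_le_integral_exp a b ?_
  · refine ⟨?_, ?_, ?_⟩
    · have := hG.integrable_exp_path (v := a) (c := fun _ => 1) (by simp)
      simp only [mul_one, ea] at this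
      exact this
    · have := hG.integrable_exp_path (v := b) (c := fun _ => 1) (by simp)
      simp only [mul_one, eb] at this
      exact this
    · simp only [ea, eb] at key
      exact key
  · intro x
    set p := gibbsWeight β (signedNormAdd ι σ ε c) x with hpdef
    have hp : ∀ z, 0 ≤ p z := gibbsWeight_nonneg _ _ _
    have hp1 : ∑ z, p z = 1 := sum_gibbsWeight _ _ _
    let N : Z → ℝ := fun z => smoothNorm ε (x z).1
    have hN : ∀ z, 0 < N z := fun z => smoothNorm_pos hε _
    let q : Z → EuclideanSpace ℝ ι := fun z => (N z)⁻¹ • (x z).1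
    have hq : ∀ z, ‖q z‖ ≤ 1 := fun z => by
      rw [norm_smul, Real.norm_eq_abs, abs_of_pos (inv_pos.2 (hN z)), inv_mul_le_iff₀ (hN z),
        mul_one]
      exact norm_le_smoothNorm ε _
    have hcov := gordon_covariance_le hp hp1 q hq v
    let d : Z → ι → ℝ := fun z i => σ * (1 / N z - (x z).1 i ^ 2 / N z ^ 3)
    have a1 : ∀ z k, A' z x (a k) = σ * (q z k.1 * v z k.2) := fun z k => by
      rw [hA', real_inner_smul_right, EuclideanSpace.inner_single_right]
      simp only [q, N, PiLp.smul_apply, smul_eq_mul, conj_trivial]; ring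
    have a2 : ∀ z (k : ι × κ), σ * (‖(a k z).1‖ ^ 2 / smoothNorm ε (x z).1 -
        inner ℝ (x z).1 (a k z).1 ^ 2 / smoothNorm ε (x z).1 ^ 3) = d z k.1 * v z k.2 ^ 2 :=
      fun z k => by
        rw [norm_smul, real_inner_smul_right, EuclideanSpace.inner_single_right,
        PiLp.norm_single]
        simp [d, N]; ring
    have b1 : ∀ z i, A' z x (b (Sum.inl i)) = σ * (q z i * ‖v z‖) := fun z i => by
      simp only [hA', b, Sum.elim_inl]
      rw [real_inner_smul_right, EuclideanSpace.inner_single_right]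
      simp only [q, N, PiLp.smul_apply, smul_eq_mul, conj_trivial]; ring
    have b2 : ∀ z i, σ * (‖(b (Sum.inl i) z).1‖ ^ 2 / smoothNorm ε (x z).1 -
        inner ℝ (x z).1 (b (Sum.inl i) z).1 ^ 2 / smoothNorm ε (x z).1 ^ 3) =
        d z i * ‖v z‖ ^ 2 := fun z i => by
      simp only [b, Sum.elim_inl]
      rw [norm_smul, real_inner_smul_right, EuclideanSpace.inner_single_right,
        PiLp.norm_single]
      simp [d, N]; ring
    have b3 : ∀ z j, A' z x (b (Sum.inr j)) = v z j := fun z j => by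
      simp only [hA', b, Sum.elim_inr]
      simp
    have b4 : ∀ z j, σ * (‖(b (Sum.inr j) z).1‖ ^ 2 / smoothNorm ε (x z).1 -
        inner ℝ (x z).1 (b (Sum.inr j) z).1 ^ 2 / smoothNorm ε (x z).1 ^ 3) = 0 := fun z j => by
      simp only [b, Sum.elim_inr]
      simp
    -- For `G = r · softMax` the operator has Gibbs mean squares with coefficient `-r (β - r)`. This
    -- is nonpositive when `r ≤ β`, which is the sign needed for `gordon_covariance_le`.
    have hsplit : ∀ S T : ℝ, r * (S - β * T ^ 2) + (r * T) ^ 2 = r * S - r * (β - r) * T ^ 2 :=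
      fun S T => by ring
    have hsq : ∀ z, ‖v z‖ ^ 2 = ∑ j, v z j ^ 2 := fun z => EuclideanSpace.real_norm_sq_eq _
    have c1 : ∑ k : ι × κ, ∑ z, p z * (β * (σ * (q z k.1 * v z k.2)) ^ 2 + d z k.1 * v z k.2 ^ 2) =
        ∑ i, ∑ z, p z * (β * (σ * (q z i * ‖v z‖)) ^ 2 + d z i * ‖v z‖ ^ 2) := by
      rw [Fintype.sum_prod_type]
      refine Finset.sum_congr rfl fun i _ => ?_
      rw [Finset.sum_comm]
      refine Finset.sum_congr rfl fun z _ => ?_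
      simp only [mul_pow, hsq, ← Finset.mul_sum, Finset.sum_add_distrib]
    have c2 : ∑ j, ∑ z, p z * (β * v z j ^ 2 + 0) = β * ∑ z, p z * ‖v z‖ ^ 2 := by
      rw [Finset.sum_comm, Finset.mul_sum]
      refine Finset.sum_congr rfl fun z _ => ?_
      rw [hsq, ← Finset.mul_sum]
      simp only [add_zero, ← Finset.mul_sum]
      ring
    have c3 : ∀ w : Z → ℝ, (∑ z, p z * (σ * w z)) ^ 2 = (∑ z, p z * w z) ^ 2 := by
      intro w
      have : ∑ z, p z * (σ * w z) = σ * ∑ z, p z * w z := by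
        rw [Finset.mul_sum]; exact Finset.sum_congr rfl fun z _ => by ring
      rw [this, mul_pow, hσ, one_mul]
    simp only [_root_.smul_apply, _root_.sum_apply, smul_eq_mul, Fintype.sum_sum_type, a1, a2, b1,
      b2, b3, b4, hsplit, Finset.sum_sub_distrib, ← Finset.mul_sum, c1, c2]
    simp only [c3]
    have hS : 0 ≤ ∑ z, p z * ‖v z‖ ^ 2 :=
      Finset.sum_nonneg fun z _ => mul_nonneg (hp z) (sq_nonneg _)
    have h1 := mul_le_mul_of_nonneg_left hcov (mul_nonneg hr (sub_nonneg.2 hrβ))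
    have h2 := mul_nonneg (sq_nonneg r) hS
    -- With `S = ∑ p ‖v‖²`, the operator difference is at least `r β S - r (β - r) S = r² S ≥ 0`; no
    -- auxiliary Gaussian has to be added to the matrix side.
    linear_combination h1 + h2

end Gordon

lemma continuous_matVec {ι κ : Type*} [Fintype κ] (v : EuclideanSpace ℝ κ) :
    Continuous fun ω : ι × κ → ℝ => matVec ω v := by
  unfold matVec
  fun_prop

/-! ### Chevet and Gordon bounds for finite families. -/

section Tail

variable {Z ι κ : Type*} [Fintype Z] [Nonempty Z] [Fintype ι] [Fintype κ]

/-- The vectors have different norms, so `‖v z‖ σ (‖g‖ - b)` can be bounded uniformly in `z` only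
through the positive part. Its exponential moment follows from `exp (max 0 y) ≤ 1 + exp y` and
concentration of `‖g‖`. -/
lemma integral_exp_mul_max_le {σ : ℝ} (hσ : σ ^ 2 = 1) (r : ℝ) :
    Integrable (fun g : EuclideanSpace ℝ ι => Real.exp (r * max 0 (σ *
      (‖g‖ - ∫ g, ‖g‖ ∂(stdGaussian (EuclideanSpace ℝ ι)))))) (stdGaussian (EuclideanSpace ℝ ι)) ∧
    ∫ g, Real.exp (r * max 0 (σ * (‖g‖ - ∫ g, ‖g‖ ∂(stdGaussian (EuclideanSpace ℝ ι)))))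
      ∂(stdGaussian (EuclideanSpace ℝ ι)) ≤ 1 + Real.exp (r ^ 2) := by
  set b := ∫ g, ‖g‖ ∂(stdGaussian (EuclideanSpace ℝ ι)) with hb
  obtain ⟨-, h2, h3⟩ := integral_exp_mul_norm_le (ι := ι) (r * σ)
  have hle : ∀ g : EuclideanSpace ℝ ι, Real.exp (r * max 0 (σ * (‖g‖ - b))) ≤
      1 + Real.exp (-(r * σ * b)) * Real.exp (r * σ * ‖g‖) := fun g => by
    rcases max_cases 0 (σ * (‖g‖ - b)) with h | h <;> rw [h.1]
    · simp; positivity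
    · rw [← Real.exp_add]
      have : r * (σ * (‖g‖ - b)) = -(r * σ * b) + r * σ * ‖g‖ := by ring
      rw [this]; linarith
  have hint : Integrable (fun g : EuclideanSpace ℝ ι =>
      1 + Real.exp (-(r * σ * b)) * Real.exp (r * σ * ‖g‖))
      (stdGaussian (EuclideanSpace ℝ ι)) := (integrable_const 1).add (h2.const_mul _)
  have hint' : Integrable (fun g : EuclideanSpace ℝ ι => Real.exp (r * max 0 (σ * (‖g‖ - b))))
      (stdGaussian (EuclideanSpace ℝ ι)) :=
    hint.mono' (by fun_prop) (ae_of_all _ fun g => by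
      rw [Real.norm_eq_abs, abs_of_pos (Real.exp_pos _)]; exact hle g)
  refine ⟨hint', (integral_mono hint' hint hle).trans ?_⟩
  rw [integral_add (integrable_const _) (h2.const_mul _), integral_const_mul]
  simp only [integral_const, probReal_univ, smul_eq_mul, mul_one]
  gcongr
  calc _ ≤ Real.exp (-(r * σ * b)) * Real.exp (r * σ * b + (r * σ) ^ 2) := by gcongr
    _ = _ := by rw [← Real.exp_add, mul_pow, hσ]; congr 1; ring

/-- The Gaussian min-max comparison theorems of Chevet (`σ = 1`) and Gordon (`σ = -1`), in
exponential form. -/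
lemma integral_exp_sup_norm_le {σ : ℝ} (hσ : σ ^ 2 = 1) (v : Z → EuclideanSpace ℝ κ) {ℓ r : ℝ}
    (hv : ∀ z, ‖v z‖ ≤ ℓ) (hr : 0 ≤ r) :
    let b := ∫ g, ‖g‖ ∂(stdGaussian (EuclideanSpace ℝ ι))
    Integrable (fun ω : ι × κ → ℝ => Real.exp (r * Finset.univ.sup' Finset.univ_nonempty
      fun z => σ * (‖matVec ω (v z)‖ - b * ‖v z‖))) (gaussianPi (ι × κ)) ∧
    ∫ ω : ι × κ → ℝ, Real.exp (r * Finset.univ.sup' Finset.univ_nonempty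
      fun z => σ * (‖matVec ω (v z)‖ - b * ‖v z‖)) ∂(gaussianPi (ι × κ)) ≤
      (1 + Real.exp ((r * ℓ) ^ 2)) *
      ∫ h, Real.exp (r * Finset.univ.sup' Finset.univ_nonempty fun z => inner ℝ (v z) h)
        ∂(stdGaussian (EuclideanSpace ℝ κ)) := by
  intro b
  have hσ1 : |σ| = 1 := by
    rw [← sq_eq_sq₀ (abs_nonneg _) zero_le_one, sq_abs, hσ, one_pow]
  -- The deterministic shift centres each norm at its mean `b ‖v z‖`, so that unequal norms are
  -- allowed.
  let c : Z → ℝ := fun z => -(σ * b * ‖v z‖)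
  let X : (ι × κ → ℝ) → ℝ := fun ω => Finset.univ.sup' Finset.univ_nonempty
      fun z => σ * (‖matVec ω (v z)‖ - b * ‖v z‖)
  let W : EuclideanSpace ℝ κ → ℝ := fun h =>
    Finset.univ.sup' Finset.univ_nonempty fun z => inner ℝ (v z) h
  have hX : Continuous X := Continuous.finset_sup'_apply _ fun z _ => by
    have := continuous_matVec (ι := ι) (v z)
    fun_prop
  have happ : ∀ {ε : ℝ}, 0 < ε → ∀ x : EuclideanSpace ℝ ι,
      σ * ‖x‖ - ε ≤ σ * smoothNorm ε x ∧ σ * smoothNorm ε x ≤ σ * ‖x‖ + ε := by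
    intro ε hε x
    have h1 : |σ * (smoothNorm ε x - ‖x‖)| ≤ ε := by
      rw [abs_mul, hσ1, one_mul, abs_of_nonneg (sub_nonneg.2 (norm_le_smoothNorm ε x))]
      linarith [smoothNorm_le hε x]
    rw [abs_le] at h1
    constructor <;> linarith [h1.1, h1.2]
  have hlow : ∀ {β : ℝ}, 0 < β → ∀ ω : ι × κ → ℝ, X ω ≤ softMax β (signedNormAdd ι σ β⁻¹ c)
      (fun z => (matVec ω (v z), 0)) + β⁻¹ := by
    intro β hβ ω
    refine Finset.sup'_le _ _ fun z _ => ?_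
    have h1 := le_softMax hβ (signedNormAdd ι σ β⁻¹ c) (fun z => (matVec ω (v z), 0)) z
    have h2 := (happ (inv_pos.2 hβ) (matVec ω (v z))).1
    simp only [signedNormAdd, c, zero_add] at h1
    linarith
  have hup : ∀ {β : ℝ}, 0 < β → ∀ ω : ι ⊕ κ → ℝ, softMax β (signedNormAdd ι σ β⁻¹ c)
      (fun z => (‖v z‖ • WithLp.toLp 2 fun i => ω (Sum.inl i), ∑ j, ω (Sum.inr j) * v z j)) ≤
      ℓ * max 0 (σ * (‖WithLp.toLp 2 fun i => ω (Sum.inl i)‖ - b)) +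
      W (WithLp.toLp 2 fun j => ω (Sum.inr j)) + β⁻¹ + Real.log (Fintype.card Z) / β := by
    intro β hβ ω
    refine softMax_le hβ _ _ fun z => ?_
    have h2 := (happ (inv_pos.2 hβ) (‖v z‖ • WithLp.toLp 2 fun i => ω (Sum.inl i))).2
    have h3 : ∑ j, ω (Sum.inr j) * v z j ≤ W (WithLp.toLp 2 fun j => ω (Sum.inr j)) := by
      refine le_trans (le_of_eq ?_) (Finset.le_sup' (fun z => inner ℝ (v z)
        (WithLp.toLp 2 fun j => ω (Sum.inr j))) (Finset.mem_univ z))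
      simp [PiLp.inner_apply]
    have h4 : σ * ‖‖v z‖ • WithLp.toLp 2 fun i => ω (Sum.inl i)‖ - σ * b * ‖v z‖ ≤
        ℓ * max 0 (σ * (‖WithLp.toLp 2 fun i => ω (Sum.inl i)‖ - b)) := by
      rw [norm_smul, norm_norm]
      calc _ = ‖v z‖ * (σ * (‖WithLp.toLp 2 fun i => ω (Sum.inl i)‖ - b)) := by ring
        _ ≤ ‖v z‖ * max 0 (σ * (‖WithLp.toLp 2 fun i => ω (Sum.inl i)‖ - b)) := by
          gcongr; exact le_max_right _ _
        _ ≤ _ := by gcongr; exact hv z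
    simp only [signedNormAdd, c]
    linarith
  have hXint : Integrable (fun ω => Real.exp (r * X ω)) (gaussianPi (ι × κ)) := by
    have hβ : 0 < r + 1 := by linarith
    have h1 := (integral_exp_softMax_le (ι := ι) c v hσ (inv_pos.2 hβ) hr hβ (by linarith)).1
    refine (h1.mul_const (Real.exp (r * (r + 1)⁻¹))).mono' (by fun_prop) (ae_of_all _ fun ω => ?_)
    rw [Real.norm_eq_abs, abs_of_pos (Real.exp_pos _), ← Real.exp_add, Real.exp_le_exp, ← mul_add]
    exact mul_le_mul_of_nonneg_left (hlow hβ ω) hr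
  refine ⟨hXint, ?_⟩
  obtain ⟨m1, m2⟩ := integral_exp_mul_max_le (ι := ι) hσ (r * ℓ)
  obtain ⟨-, w1, -⟩ := integral_exp_mul_sup_inner_le v hv r
  have hW0 : 0 ≤ ∫ h, Real.exp (r * W h) ∂(stdGaussian (EuclideanSpace ℝ κ)) :=
    integral_nonneg fun _ => (Real.exp_pos _).le
  refine le_trans ?_ (mul_le_mul_of_nonneg_right m2 hW0)
  have mp := measurePreserving_sumPiEquivProdPi (fun _ : ι ⊕ κ => gaussianReal 0 1)
  have hprod := ((integrable_stdGaussian_iff _).1 m1).mul_prod ((integrable_stdGaussian_iff _).1 w1)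
  have hcomp := mp.integrable_comp_of_integrable hprod
  have hval : ∫ ω : ι ⊕ κ → ℝ, Real.exp (r * ℓ *
      max 0 (σ * (‖WithLp.toLp 2 fun i => ω (Sum.inl i)‖ - b))) *
      Real.exp (r * W (WithLp.toLp 2 fun j => ω (Sum.inr j))) ∂(gaussianPi (ι ⊕ κ)) =
      (∫ g, Real.exp (r * ℓ * max 0 (σ * (‖g‖ - b))) ∂(stdGaussian (EuclideanSpace ℝ ι))) *
      ∫ h, Real.exp (r * W h) ∂(stdGaussian (EuclideanSpace ℝ κ)) := by
    rw [integral_stdGaussian_eq, integral_stdGaussian_eq, ← integral_prod_mul,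
      ← mp.integral_comp (MeasurableEquiv.measurableEmbedding _)]
    rfl
  rw [← hval]
  set I := ∫ ω : ι ⊕ κ → ℝ, Real.exp (r * ℓ *
      max 0 (σ * (‖WithLp.toLp 2 fun i => ω (Sum.inl i)‖ - b))) *
      Real.exp (r * W (WithLp.toLp 2 fun j => ω (Sum.inr j))) ∂(gaussianPi (ι ⊕ κ)) with hI
  -- Smoothing with `ε = β⁻¹` costs `β⁻¹` on each side and softmax costs `log |Z| / β`; all of it
  -- vanishes as `β → ∞`.
  have hlim : Filter.Tendsto (fun β : ℝ => I * Real.exp (r * (2 + Real.log (Fintype.card Z)) * β⁻¹))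
      Filter.atTop (nhds I) := by
    have : Filter.Tendsto (fun β : ℝ => I * Real.exp (r * (2 + Real.log (Fintype.card Z)) * β⁻¹))
        Filter.atTop (nhds (I * Real.exp (r * (2 + Real.log (Fintype.card Z)) * 0))) :=
      ((Real.continuous_exp.tendsto _).comp (tendsto_inv_atTop_zero.const_mul _)).const_mul _
    simpa using this
  refine ge_of_tendsto hlim ?_
  filter_upwards [Filter.eventually_ge_atTop (r + 1)] with β hβr
  have hβ : 0 < β := by linarith
  obtain ⟨s1, s2, s3⟩ := integral_exp_softMax_le (ι := ι) c v hσ (inv_pos.2 hβ) hr hβ (by linarith)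
  calc ∫ ω, Real.exp (r * X ω) ∂(gaussianPi (ι × κ))
      ≤ ∫ ω : ι × κ → ℝ, Real.exp (r * softMax β (signedNormAdd ι σ β⁻¹ c)
        fun z => (matVec ω (v z), 0)) * Real.exp (r * β⁻¹) ∂(gaussianPi (ι × κ)) := by
        refine integral_mono hXint (s1.mul_const _) fun ω => ?_
        simp only
        rw [← Real.exp_add, Real.exp_le_exp, ← mul_add]
        exact mul_le_mul_of_nonneg_left (hlow hβ ω) hr
    _ ≤ (∫ ω : ι ⊕ κ → ℝ, Real.exp (r * softMax β (signedNormAdd ι σ β⁻¹ c)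
        fun z => (‖v z‖ • WithLp.toLp 2 fun i => ω (Sum.inl i), ∑ j, ω (Sum.inr j) * v z j))
        ∂(gaussianPi (ι ⊕ κ))) * Real.exp (r * β⁻¹) := by
        rw [integral_mul_const]
        gcongr
    _ ≤ (I * Real.exp (r * (1 + Real.log (Fintype.card Z)) * β⁻¹)) * Real.exp (r * β⁻¹) := by
        gcongr
        rw [hI, ← integral_mul_const]
        refine integral_mono s2 (hcomp.mul_const _) fun ω => ?_
        simp only
        refine le_trans (Real.exp_le_exp.2 (mul_le_mul_of_nonneg_left (hup hβ ω) hr)) (le_of_eq ?_)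
        rw [← Real.exp_add, ← Real.exp_add]
        congr 1
        ring
    _ = _ := by rw [mul_assoc, ← Real.exp_add]; congr 2; ring

/-- Two-sided control of `‖A (u + s w)‖` over finite families, for a Gaussian matrix `A`. -/
lemma measure_norm_matVec_add_le {Y : Type*} [Fintype Y] [Nonempty Y] {σ s : ℝ} (hσ : σ ^ 2 = 1)
    (u : Z → EuclideanSpace ℝ κ) (w : Y → EuclideanSpace ℝ κ) (hu : ∀ i, ‖u i‖ ≤ 1)
    (hw : ∀ j, ‖s • w j‖ ≤ 1) {a η : ℝ} (hη : 0 ≤ η)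
    (hua : ∫ h, Finset.univ.sup' Finset.univ_nonempty (fun i => inner ℝ (u i) h)
      ∂(stdGaussian (EuclideanSpace ℝ κ)) ≤ a)
    (hwa : ∫ h, Finset.univ.sup' Finset.univ_nonempty (fun j => inner ℝ (s • w j) h)
      ∂(stdGaussian (EuclideanSpace ℝ κ)) ≤ a) :
    let b := ∫ g, ‖g‖ ∂(stdGaussian (EuclideanSpace ℝ ι))
    (gaussianPi (ι × κ)).real {ω | ∃ i j, 2 * a + 2 * η ≤
      σ * (‖matVec ω (u i + s • w j)‖ - b * ‖u i + s • w j‖)} ≤ 2 * Real.exp (-η ^ 2 / 8) := by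
  intro b
  -- With `r = η/8` and `ℓ = 2` the Chernoff exponent is `-(η/8)(2a + 2η) + η²/16 + (ηa/4 + η²/16) =
  -- -η²/8`.
  obtain ⟨i1, i2⟩ := integral_exp_sup_norm_le (ι := ι) hσ
    (fun p : Z × Y => u p.1 + s • w p.2) (ℓ := 2) (r := η / 8)
    (fun p => (norm_add_le _ _).trans (by linarith [hu p.1, hw p.2])) (by positivity)
  obtain ⟨-, u1, u2⟩ := integral_exp_mul_sup_inner_le u hu (2 * (η / 8))
  obtain ⟨-, w1, w2⟩ := integral_exp_mul_sup_inner_le (fun j => s • w j) hw (2 * (η / 8))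
  obtain ⟨-, z1, -⟩ := integral_exp_mul_sup_inner_le (fun p : Z × Y => u p.1 + s • w p.2) (L := 2)
    (fun p => (norm_add_le _ _).trans (by linarith [hu p.1, hw p.2])) (η / 8)
  have hr : 0 ≤ η / 8 := by positivity
  have hbd : ∀ {x : ℝ}, x ≤ a → Real.exp (2 * (η / 8) * x + (2 * (η / 8)) ^ 2 * 1 ^ 2) ≤
      Real.exp (η / 4 * a + η ^ 2 / 16) := fun {x} hx => by
    rw [Real.exp_le_exp]
    nlinarith [mul_le_mul_of_nonneg_left hx hr]
  -- The supremum over pairs is at most the sum of the two suprema, and `e^{x+y} ≤ (e^{2x} +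
  -- e^{2y})/2` separates them without independence.
  have h2 : ∫ h, Real.exp (η / 8 * Finset.univ.sup' Finset.univ_nonempty
      fun p : Z × Y => inner ℝ (u p.1 + s • w p.2) h) ∂(stdGaussian (EuclideanSpace ℝ κ)) ≤
      Real.exp (η / 4 * a + η ^ 2 / 16) := by
    calc _ ≤ ∫ h, (Real.exp (2 * (η / 8) * Finset.univ.sup' Finset.univ_nonempty
          (fun i => inner ℝ (u i) h)) + Real.exp (2 * (η / 8) * Finset.univ.sup'
          Finset.univ_nonempty (fun j => inner ℝ (s • w j) h))) / 2
          ∂(stdGaussian (EuclideanSpace ℝ κ)) := by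
          refine integral_mono z1 ((u1.add w1).div_const 2) fun h => ?_
          simp only
          set x := Finset.univ.sup' Finset.univ_nonempty (fun i => inner ℝ (u i) h)
          set y := Finset.univ.sup' Finset.univ_nonempty (fun j => inner ℝ (s • w j) h)
          have hxy : Finset.univ.sup' Finset.univ_nonempty
              (fun p : Z × Y => inner ℝ (u p.1 + s • w p.2) h) ≤ x + y := by
            refine Finset.sup'_le _ _ fun p _ => ?_
            rw [inner_add_left]
            exact add_le_add
              (Finset.le_sup' (fun i => inner ℝ (u i) h) (Finset.mem_univ p.1))
              (Finset.le_sup' (fun j => inner ℝ (s • w j) h) (Finset.mem_univ p.2))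
          have e1 : Real.exp (2 * (η / 8) * x) = Real.exp (η / 8 * x) ^ 2 := by
            rw [← Real.exp_nat_mul]; congr 1; push_cast; ring
          have e2 : Real.exp (2 * (η / 8) * y) = Real.exp (η / 8 * y) ^ 2 := by
            rw [← Real.exp_nat_mul]; congr 1; push_cast; ring
          calc _ ≤ Real.exp (η / 8 * (x + y)) := by gcongr
            _ = Real.exp (η / 8 * x) * Real.exp (η / 8 * y) := by rw [mul_add, Real.exp_add]
            _ ≤ _ := by
              rw [e1, e2]
              nlinarith [sq_nonneg (Real.exp (η / 8 * x) - Real.exp (η / 8 * y))]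
      _ ≤ _ := by
          rw [integral_div, integral_add u1 w1]
          linarith [u2.trans (hbd hua), w2.trans (hbd hwa)]
  have hmarkov := measure_ge_le_exp_mul_mgf (μ := gaussianPi (ι × κ)) (2 * a + 2 * η) hr i1
  have hset : {ω : ι × κ → ℝ | ∃ i j, 2 * a + 2 * η ≤
      σ * (‖matVec ω (u i + s • w j)‖ - b * ‖u i + s • w j‖)} =
      {ω | 2 * a + 2 * η ≤ Finset.univ.sup' Finset.univ_nonempty
        fun p : Z × Y => σ * (‖matVec ω (u p.1 + s • w p.2)‖ - b * ‖u p.1 + s • w p.2‖)} := by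
    ext ω
    simp [Finset.le_sup'_iff]
  rw [hset]
  refine hmarkov.trans ?_
  have h3 : 1 + Real.exp ((η / 8 * 2) ^ 2) ≤ 2 * Real.exp (η ^ 2 / 16) := by
    have : (η / 8 * 2) ^ 2 = η ^ 2 / 16 := by ring
    rw [this]
    have := Real.one_le_exp (show 0 ≤ η ^ 2 / 16 by positivity)
    linarith
  calc _ ≤ Real.exp (-(η / 8) * (2 * a + 2 * η)) * ((2 * Real.exp (η ^ 2 / 16)) *
        Real.exp (η / 4 * a + η ^ 2 / 16)) := by
        refine mul_le_mul_of_nonneg_left (i2.trans ?_) (Real.exp_pos _).le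
        exact mul_le_mul h3 h2 (integral_nonneg fun _ => (Real.exp_pos _).le) (by positivity)
    _ = 2 * (Real.exp (-(η / 8) * (2 * a + 2 * η)) * Real.exp (η ^ 2 / 16) *
        Real.exp (η / 4 * a + η ^ 2 / 16)) := by ring
    _ = _ := by
        rw [← Real.exp_add, ← Real.exp_add]
        congr 2
        ring

end Tail

/-! ### The function `φ`. -/

section Phi

lemma phi_pos {t : ℝ} (ht : 0 < t) : 0 < PGD.phi t := by
  unfold PGD.phi
  have h1 := Real.Gamma_pos_of_pos (show 0 < (t + 1) / 2 by positivity)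
  have h2 := Real.Gamma_pos_of_pos (show 0 < t / 2 by positivity)
  positivity

lemma phi_zero : PGD.phi 0 = 0 := by simp [PGD.phi]

lemma phi_mul_phi_add_one {t : ℝ} (ht : 0 < t) : PGD.phi t * PGD.phi (t + 1) = t := by
  unfold PGD.phi
  have h1 := (Real.Gamma_pos_of_pos (show 0 < (t + 1) / 2 by positivity)).ne'
  have h2 := (Real.Gamma_pos_of_pos (show 0 < t / 2 by positivity)).ne'
  have h3 : (t + 1 + 1) / 2 = t / 2 + 1 := by ring
  rw [h3, Real.Gamma_add_one (by positivity)]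
  field_simp
  rw [Real.sq_sqrt zero_le_two]

/-- Log-convexity of `Γ` at the midpoint `(t+1)/2` of `t/2` and `t/2 + 1`. -/
lemma phi_sq_le {t : ℝ} (ht : 0 < t) : PGD.phi t ^ 2 ≤ t := by
  have h1 := Real.Gamma_pos_of_pos (show 0 < (t + 1) / 2 by positivity)
  have h2 := Real.Gamma_pos_of_pos (show 0 < t / 2 by positivity)
  have h3 := Real.Gamma_mul_add_mul_le_rpow_Gamma_mul_rpow_Gamma
    (show 0 < t / 2 by positivity) (show 0 < t / 2 + 1 by positivity)
    (show (0 : ℝ) < 1 / 2 by norm_num) (show (0 : ℝ) < 1 / 2 by norm_num) (by norm_num)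
  rw [show (1 : ℝ) / 2 * (t / 2) + 1 / 2 * (t / 2 + 1) = (t + 1) / 2 by ring,
    Real.Gamma_add_one (by positivity), ← Real.sqrt_eq_rpow, ← Real.sqrt_eq_rpow,
    ← Real.sqrt_mul h2.le] at h3
  have h4 : Real.Gamma ((t + 1) / 2) ^ 2 ≤ t / 2 * Real.Gamma (t / 2) ^ 2 := by
    calc _ ≤ (√(Real.Gamma (t / 2) * (t / 2 * Real.Gamma (t / 2)))) ^ 2 := by gcongr
      _ = _ := by rw [Real.sq_sqrt (by positivity)]; ring
  unfold PGD.phi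
  rw [div_pow, mul_pow, Real.sq_sqrt zero_le_two, div_le_iff₀ (by positivity)]
  linarith

lemma sq_div_add_one_le_phi_sq {t : ℝ} (ht : 0 < t) : t ^ 2 / (t + 1) ≤ PGD.phi t ^ 2 := by
  have h1 := phi_sq_le (show 0 < t + 1 by positivity)
  rw [div_le_iff₀ (by positivity)]
  calc t ^ 2 = PGD.phi t ^ 2 * PGD.phi (t + 1) ^ 2 := by
        rw [← mul_pow, phi_mul_phi_add_one ht]
    _ ≤ _ := by gcongr

lemma phi_sq_div_add_two {t : ℝ} (ht : 0 < t) :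
    PGD.phi t ^ 2 / t = (PGD.phi (t + 2) ^ 2 / (t + 2)) * (1 - 1 / (t + 1) ^ 2) := by
  have h1 := phi_mul_phi_add_one ht
  have h2 := phi_mul_phi_add_one (show 0 < t + 1 by positivity)
  have h3 := phi_pos ht
  have h4 := phi_pos (show 0 < t + 1 by positivity)
  rw [show t + 1 + 1 = t + 2 by ring] at h2
  have e1 : PGD.phi t = t / PGD.phi (t + 1) := by rw [eq_div_iff h4.ne']; exact h1
  have e2 : PGD.phi (t + 2) = (t + 1) / PGD.phi (t + 1) := by
    rw [eq_div_iff h4.ne', mul_comm]; exact h2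
  rw [e1, e2]
  field_simp
  ring

/-- With `R(t) = φ(t)²/t`, this says that `R(s)/R(t)` does not decrease when both arguments are
shifted by `2k`: by `phi_sq_div_add_two` each shift by 2 divides `R` by `1 - 1/(t+1)²`, which is
closer to 1 for the larger argument. -/
lemma phi_sq_div_mul_le {s t : ℝ} (hs : 0 < s) (hst : s ≤ t) (k : ℕ) :
    PGD.phi s ^ 2 / s * (PGD.phi (t + 2 * k) ^ 2 / (t + 2 * k)) ≤
      PGD.phi t ^ 2 / t * (PGD.phi (s + 2 * k) ^ 2 / (s + 2 * k)) := by
  have ht : 0 < t := hs.trans_le hst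
  induction k with
  | zero => simp [mul_comm]
  | succ k ih =>
    have hs' : 0 < s + 2 * k := by positivity
    have ht' : 0 < t + 2 * k := by positivity
    rw [phi_sq_div_add_two hs', phi_sq_div_add_two ht'] at ih
    have e : ∀ x : ℝ, x + 2 * ((k + 1 : ℕ) : ℝ) = x + 2 * k + 2 := fun x => by push_cast; ring
    rw [e, e]
    have hc : 1 - 1 / (s + 2 * k + 1) ^ 2 ≤ 1 - 1 / (t + 2 * k + 1) ^ 2 := by gcongr
    have hpos : 0 < 1 - 1 / (t + 2 * k + 1) ^ 2 := by
      rw [sub_pos, div_lt_one (by positivity)]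
      nlinarith
    refine le_of_mul_le_mul_right ?_ hpos
    calc _ = PGD.phi s ^ 2 / s * (PGD.phi (t + 2 * k + 2) ^ 2 / (t + 2 * k + 2) *
          (1 - 1 / (t + 2 * k + 1) ^ 2)) := by ring
      _ ≤ _ := ih
      _ = PGD.phi t ^ 2 / t * (PGD.phi (s + 2 * k + 2) ^ 2 / (s + 2 * k + 2)) *
          (1 - 1 / (s + 2 * k + 1) ^ 2) := by ring
      _ ≤ _ := by gcongr

/-- Let `k → ∞` in `phi_sq_div_mul_le`: since `t/(t+1) ≤ φ(t)²/t ≤ 1`, both shifted quotients tend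
to 1. -/
lemma phi_sq_div_mono {s t : ℝ} (hs : 0 < s) (hst : s ≤ t) :
    PGD.phi s ^ 2 / s ≤ PGD.phi t ^ 2 / t := by
  have ht : 0 < t := hs.trans_le hst
  have key : ∀ k : ℕ, PGD.phi s ^ 2 / s * (1 - 1 / ((k : ℝ) + 1)) ≤ PGD.phi t ^ 2 / t := by
    intro k
    have hs' : 0 < s + 2 * k := by positivity
    have ht' : 0 < t + 2 * k := by positivity
    have h1 := phi_sq_div_mul_le hs hst k
    have h2 : PGD.phi (s + 2 * k) ^ 2 / (s + 2 * k) ≤ 1 := by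
      rw [div_le_one hs']; exact phi_sq_le hs'
    have h3 : 1 - 1 / ((k : ℝ) + 1) ≤ PGD.phi (t + 2 * k) ^ 2 / (t + 2 * k) := by
      have h4 := sq_div_add_one_le_phi_sq ht'
      rw [le_div_iff₀ ht']
      refine le_trans ?_ h4
      have e : (t + 2 * (k : ℝ)) ^ 2 / (t + 2 * k + 1) =
          (1 - 1 / (t + 2 * k + 1)) * (t + 2 * k) := by field_simp; ring
      rw [e]
      have : (k : ℝ) + 1 ≤ t + 2 * k + 1 := by
        have : (0 : ℝ) ≤ k := k.cast_nonneg
        linarith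
      gcongr
    calc _ ≤ PGD.phi s ^ 2 / s * (PGD.phi (t + 2 * k) ^ 2 / (t + 2 * k)) := by gcongr
      _ ≤ _ := h1
      _ ≤ PGD.phi t ^ 2 / t * 1 := by gcongr
      _ = _ := mul_one _
  have hlim : Filter.Tendsto (fun k : ℕ => PGD.phi s ^ 2 / s * (1 - 1 / ((k : ℝ) + 1)))
      Filter.atTop (nhds (PGD.phi s ^ 2 / s * (1 - 0))) :=
    (tendsto_one_div_add_atTop_nhds_zero_nat.const_sub 1).const_mul _
  rw [sub_zero, mul_one] at hlim
  exact le_of_tendsto' hlim key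

lemma continuousOn_phi : ContinuousOn PGD.phi (Set.Ioi 0) := by
  have hG : ∀ x : ℝ, 0 < x → ContinuousAt Real.Gamma x := fun x hx =>
    (Real.differentiableAt_Gamma fun m h => by
      have : (0 : ℝ) ≤ m := m.cast_nonneg
      linarith).continuousAt
  intro t ht
  have ht' : 0 < t := ht
  refine ContinuousAt.continuousWithinAt ?_
  unfold PGD.phi
  refine ContinuousAt.div (continuousAt_const.mul ?_) ?_
    (Real.Gamma_pos_of_pos (by positivity)).ne'
  · exact ContinuousAt.comp (f := fun t : ℝ => (t + 1) / 2) (hG _ (by positivity)) (by fun_prop)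
  · exact ContinuousAt.comp (f := fun t : ℝ => t / 2) (hG _ (by positivity)) (by fun_prop)

/-- Surjectivity is all that is needed for `invFunOn` to return a genuine preimage. The bounds on
`φ²` place one between `y²` and `y² + 1`. -/
lemma exists_phi_eq {y : ℝ} (hy : 0 ≤ y) : ∃ t ∈ Set.Ici (0 : ℝ), PGD.phi t = y := by
  rcases hy.eq_or_lt with rfl | hy
  · exact ⟨0, Set.self_mem_Ici, phi_zero⟩
  · have h1 : PGD.phi (y ^ 2) ≤ y :=
      abs_le_of_sq_le_sq' (phi_sq_le (by positivity)) hy.le |>.2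
    have h2 : y ≤ PGD.phi (y ^ 2 + 1) := by
      have h0 := phi_pos (show 0 < y ^ 2 + 1 by positivity)
      refine abs_le_of_sq_le_sq' ?_ h0.le |>.2
      refine le_trans ?_ (sq_div_add_one_le_phi_sq (show 0 < y ^ 2 + 1 by positivity))
      rw [le_div_iff₀ (by positivity)]
      nlinarith
    obtain ⟨t, ht, he⟩ := intermediate_value_Icc (show y ^ 2 ≤ y ^ 2 + 1 by linarith)
      (continuousOn_phi.mono fun t ht => lt_of_lt_of_le (by positivity) ht.1) ⟨h1, h2⟩
    exact ⟨t, le_trans (by positivity) ht.1, he⟩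

lemma two_div_pi_mul_le_phi_sq {t : ℝ} (ht : 1 ≤ t) : 2 / Real.pi * t ≤ PGD.phi t ^ 2 := by
  have h1 := phi_sq_div_mono one_pos ht
  have h2 : PGD.phi 1 ^ 2 = 2 / Real.pi := by
    unfold PGD.phi
    rw [show ((1 : ℝ) + 1) / 2 = 1 by norm_num, Real.Gamma_one, Real.Gamma_one_half_eq, div_pow,
      mul_one, Real.sq_sqrt zero_le_two, Real.sq_sqrt Real.pi_pos.le]
  rw [h2, div_one, le_div_iff₀ (by linarith)] at h1
  exact h1

end Phi

/-! ### The mean norm of a standard Gaussian vector. -/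

section Chi

variable {E : Type*} [NormedAddCommGroup E] [InnerProductSpace ℝ E] [FiniteDimensional ℝ E]
  [MeasurableSpace E] [BorelSpace E]

lemma integrable_exp_neg_half_norm_sq :
    Integrable (fun x : E => Real.exp (-(1 / 2) * ‖x‖ ^ 2)) := by
  have h := GaussianFourier.integrable_cexp_neg_mul_sq_norm_add (V := E) (b := ((1 / 2 : ℝ) : ℂ))
    (by rw [Complex.ofReal_re]; norm_num) 0 0
  refine h.norm.congr (ae_of_all _ fun x => ?_)
  simp only [zero_mul, add_zero, Complex.norm_exp]
  congr 1
  rw [← Complex.ofReal_pow, ← Complex.ofReal_neg, ← Complex.ofReal_mul, Complex.ofReal_re]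

lemma integral_exp_neg_half_norm_sq_pos :
    0 < ∫ x : E, Real.exp (-(1 / 2) * ‖x‖ ^ 2) := by
  rw [GaussianFourier.integral_rexp_neg_mul_sq_norm (by norm_num)]
  have := Real.pi_pos
  positivity

/-- The density of the standard Gaussian measure. -/
lemma stdGaussian_eq_withDensity :
    stdGaussian E = (volume : Measure E).withDensity fun x =>
      ENNReal.ofReal ((∫ x : E, Real.exp (-(1 / 2) * ‖x‖ ^ 2))⁻¹ *
        Real.exp (-(1 / 2) * ‖x‖ ^ 2)) := by
  set c := ∫ x : E, Real.exp (-(1 / 2) * ‖x‖ ^ 2) with hc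
  have hcpos : 0 < c := integral_exp_neg_half_norm_sq_pos
  have hfin : IsFiniteMeasure ((volume : Measure E).withDensity fun x =>
      ENNReal.ofReal (c⁻¹ * Real.exp (-(1 / 2) * ‖x‖ ^ 2))) :=
    isFiniteMeasure_withDensity_ofReal (integrable_exp_neg_half_norm_sq.const_mul _).2
  refine Measure.ext_of_charFun ?_
  ext t
  rw [charFun_stdGaussian, charFun_apply,
    integral_withDensity_eq_integral_toReal_smul (by fun_prop)
      (ae_of_all _ fun _ => ENNReal.ofReal_lt_top)]
  have hb : 0 < (((1 / 2 : ℝ) : ℂ)).re := by rw [Complex.ofReal_re]; norm_num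
  have h1 := GaussianFourier.integral_cexp_neg_mul_sq_norm_add (V := E) hb Complex.I t
  have h2 := GaussianFourier.integral_cexp_neg_mul_sq_norm (V := E) hb
  have h3 : ∫ v : E, Complex.exp (-((1 / 2 : ℝ) : ℂ) * ‖v‖ ^ 2) = (c : ℂ) := by
    rw [hc, ← integral_complex_ofReal]
    refine integral_congr_ae (ae_of_all _ fun x => ?_)
    simp
  rw [← h2, h3] at h1
  have h4 : ∀ x : E, (ENNReal.ofReal (c⁻¹ * Real.exp (-(1 / 2) * ‖x‖ ^ 2))).toReal •
      Complex.exp (inner ℝ x t * Complex.I) = (c : ℂ)⁻¹ *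
      Complex.exp (-((1 / 2 : ℝ) : ℂ) * ‖x‖ ^ 2 + Complex.I * inner ℝ t x) := by
    intro x
    rw [ENNReal.toReal_ofReal (by positivity), Complex.real_smul, Complex.exp_add,
      real_inner_comm, mul_comm Complex.I]
    push_cast
    ring
  simp only [h4]
  rw [integral_const_mul, h1, ← mul_assoc, inv_mul_cancel₀ (by exact_mod_cast hcpos.ne'), one_mul]
  congr 1
  rw [Complex.I_sq]
  push_cast
  ring

/-- The mean of the chi distribution. -/
lemma integral_norm_stdGaussian [Nontrivial E] :
    ∫ x, ‖x‖ ∂(stdGaussian E) = PGD.phi (Module.finrank ℝ E) := by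
  set d := Module.finrank ℝ E with hd
  have hd0 : 0 < d := Module.finrank_pos
  have hcpos := integral_exp_neg_half_norm_sq_pos (E := E)
  have hc := integral_fun_norm_addHaar (volume : Measure E)
    (fun r : ℝ => Real.exp (-(1 / 2) * r ^ 2))
  have hn := integral_fun_norm_addHaar (volume : Measure E)
    (fun r : ℝ => r * Real.exp (-(1 / 2) * r ^ 2))
  rw [stdGaussian_eq_withDensity, integral_withDensity_eq_integral_toReal_smul (by fun_prop)
      (ae_of_all _ fun _ => ENNReal.ofReal_lt_top)]
  set c := ∫ x : E, Real.exp (-(1 / 2) * ‖x‖ ^ 2) with hcdef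
  have h1 : ∀ x : E, (ENNReal.ofReal (c⁻¹ * Real.exp (-(1 / 2) * ‖x‖ ^ 2))).toReal • ‖x‖ =
      c⁻¹ * (‖x‖ * Real.exp (-(1 / 2) * ‖x‖ ^ 2)) := fun x => by
    rw [ENNReal.toReal_ofReal (by positivity), smul_eq_mul]; ring
  simp only [h1]
  rw [integral_const_mul, hn]
  have e1 : ∫ y in Set.Ioi (0 : ℝ), y ^ (d - 1) • (y * Real.exp (-(1 / 2) * y ^ 2)) =
      (1 / 2) ^ (-((d : ℝ) + 1) / 2) * (1 / 2) * Real.Gamma (((d : ℝ) + 1) / 2) := by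
    rw [← integral_rpow_mul_exp_neg_mul_rpow two_pos
      (neg_one_lt_zero.trans (by exact_mod_cast hd0 : (0 : ℝ) < d)) (by norm_num)]
    refine setIntegral_congr_fun measurableSet_Ioi fun y hy => ?_
    simp only [smul_eq_mul, Real.rpow_natCast, Real.rpow_two]
    rw [← mul_assoc, ← pow_succ, Nat.sub_add_cancel hd0]
  have e2 : ∫ y in Set.Ioi (0 : ℝ), y ^ (d - 1) • Real.exp (-(1 / 2) * y ^ 2) =
      (1 / 2) ^ (-(d : ℝ) / 2) * (1 / 2) * Real.Gamma ((d : ℝ) / 2) := by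
    have h := integral_rpow_mul_exp_neg_mul_rpow (p := 2) (q := (d : ℝ) - 1) (b := 1 / 2) two_pos
      (by linarith [(by exact_mod_cast hd0 : (0 : ℝ) < d)]) (by norm_num)
    rw [sub_add_cancel] at h
    rw [← h]
    refine setIntegral_congr_fun measurableSet_Ioi fun y hy => ?_
    have : ((d : ℝ) - 1) = ((d - 1 : ℕ) : ℝ) := by rw [Nat.cast_sub hd0, Nat.cast_one]
    simp only [smul_eq_mul, this, Real.rpow_natCast, Real.rpow_two]
  rw [e2] at hc
  rw [e1]
  simp only [nsmul_eq_mul, smul_eq_mul] at hc ⊢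
  rw [← hd] at hc
  have hG := Real.Gamma_pos_of_pos (show 0 < (d : ℝ) / 2 by positivity)
  -- The polar-coordinate constant cancels between the two radial integrals; it is nonzero because
  -- the Gaussian integral is positive.
  have hA : (d : ℝ) * volume.real (Metric.ball (0 : E) 1) ≠ 0 := by
    intro h
    rw [← mul_assoc, h, zero_mul] at hc
    exact hcpos.ne' hc
  have hp : (1 / 2 : ℝ) ^ (-((d : ℝ) + 1) / 2) = (1 / 2 : ℝ) ^ (-(d : ℝ) / 2) * √2 := by
    rw [show -((d : ℝ) + 1) / 2 = -(d : ℝ) / 2 + -(1 / 2) by ring, Real.rpow_add (by norm_num),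
      Real.rpow_neg (by norm_num), ← Real.sqrt_eq_rpow]
    congr 1
    rw [one_div, Real.sqrt_inv, inv_inv]
  have hq : (1 / 2 : ℝ) ^ (-(d : ℝ) / 2) ≠ 0 := by positivity
  have hV := right_ne_zero_of_mul hA
  rw [hc, hp, ← hd]
  unfold PGD.phi
  field_simp

end Chi

/-! ### Gaussian width. -/

section Width

variable {n : ℕ} {T : Set (EuclideanSpace ℝ (Fin n))}

lemma bddAbove_inner_image (hT : T ⊆ Metric.closedBall 0 1) (g : EuclideanSpace ℝ (Fin n)) :
    BddAbove ((fun z => inner ℝ g z) '' T) := by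
  refine ⟨‖g‖, ?_⟩
  rintro _ ⟨z, hz, rfl⟩
  have hz' : ‖z‖ ≤ 1 := by simpa using hT hz
  exact (real_inner_le_norm _ _).trans (mul_le_of_le_one_right (norm_nonneg _) hz')

lemma lipschitzWith_sSup_inner (hT : T ⊆ Metric.closedBall 0 1) (hne : T.Nonempty) :
    LipschitzWith 1 fun g : EuclideanSpace ℝ (Fin n) => sSup ((fun z => inner ℝ g z) '' T) := by
  refine LipschitzWith.of_le_add fun g h => ?_
  refine csSup_le (hne.image _) ?_
  rintro _ ⟨z, hz, rfl⟩
  have hz' : ‖z‖ ≤ 1 := by simpa using hT hz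
  have h1 : inner ℝ h z ≤ sSup ((fun z => inner ℝ h z) '' T) :=
    le_csSup (bddAbove_inner_image hT h) ⟨z, hz, rfl⟩
  have h2 : inner ℝ (g - h) z ≤ dist g h := by
    rw [dist_eq_norm]
    exact (real_inner_le_norm _ _).trans (mul_le_of_le_one_right (norm_nonneg _) hz')
  rw [inner_sub_left] at h2
  dsimp only
  linarith

lemma integrable_sSup_inner (hT : T ⊆ Metric.closedBall 0 1) (hne : T.Nonempty) :
    Integrable (fun g => sSup ((fun z => inner ℝ g z) '' T))
      (stdGaussian (EuclideanSpace ℝ (Fin n))) := by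
  have hL := lipschitzWith_sSup_inner hT hne
  refine (IsGaussian.integrable_id (μ := stdGaussian (EuclideanSpace ℝ (Fin n)))).norm.mono'
    hL.continuous.aestronglyMeasurable (ae_of_all _ fun g => ?_)
  have h := hL.dist_le_mul g 0
  have h0 : sSup ((fun z => inner ℝ (0 : EuclideanSpace ℝ (Fin n)) z) '' T) = 0 := by
    simp [hne.image_const]
  rw [h0] at h
  simpa using h

lemma integral_sup_inner_le_gaussianWidth (hT : T ⊆ Metric.closedBall 0 1) {Z : Type*} [Fintype Z]
    [Nonempty Z] {u : Z → EuclideanSpace ℝ (Fin n)} (hu : ∀ z, u z ∈ T) :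
    ∫ h, Finset.univ.sup' Finset.univ_nonempty (fun i => inner ℝ (u i) h)
      ∂(stdGaussian (EuclideanSpace ℝ (Fin n))) ≤ PGD.gaussianWidth T := by
  have hne : T.Nonempty := ⟨_, hu (Classical.arbitrary Z)⟩
  refine integral_mono (integral_exp_mul_sup_inner_le u (L := 1)
    (fun z => by simpa using hT (hu z)) 0).1 (integrable_sSup_inner hT hne) fun h => ?_
  refine Finset.sup'_le _ _ fun i _ => ?_
  rw [real_inner_comm]
  exact le_csSup (bddAbove_inner_image hT h) ⟨_, hu i, rfl⟩

/-- The law of `h` is symmetric. This serves the differences `u - v`, where the second family is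
`-v`. -/
lemma integral_sup_inner_neg_le_gaussianWidth (hT : T ⊆ Metric.closedBall 0 1) {Z : Type*}
    [Fintype Z] [Nonempty Z] {u : Z → EuclideanSpace ℝ (Fin n)} (hu : ∀ z, u z ∈ T) :
    ∫ h, Finset.univ.sup' Finset.univ_nonempty (fun i => inner ℝ (-u i) h)
      ∂(stdGaussian (EuclideanSpace ℝ (Fin n))) ≤ PGD.gaussianWidth T := by
  refine le_trans (le_of_eq ?_) (integral_sup_inner_le_gaussianWidth hT hu)
  conv_rhs => rw [← stdGaussian_map (LinearIsometryEquiv.neg ℝ)]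
  rw [integral_map (by fun_prop)]
  · simp
  · refine Continuous.aestronglyMeasurable ?_
    exact Continuous.finset_sup'_apply _ fun i _ => by fun_prop

lemma gaussianWidth_singleton (p : EuclideanSpace ℝ (Fin n)) : PGD.gaussianWidth {p} = 0 := by
  unfold PGD.gaussianWidth
  simp only [Set.image_singleton, csSup_singleton]
  simpa [real_inner_comm] using integral_strongDual_stdGaussian (innerSL ℝ p)

lemma gaussianWidth_nonneg (hT : T ⊆ Metric.closedBall 0 1) (h0 : 0 ∈ T) :
    0 ≤ PGD.gaussianWidth T :=
  integral_nonneg fun g => le_csSup_of_le (bddAbove_inner_image hT g) ⟨0, h0, rfl⟩ (by simp)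

end Width

/-! ### The noise term, and passage from finite to separable families. -/

section Tail

variable {m n : ℕ}

/-- For a unit vector `v`, the vector `Aᵀ v` is standard Gaussian: testing it against `t` is testing
the matrix against `v ⊗ t`, whose norm is `‖t‖`. -/
lemma measurePreserving_vecMul {v : EuclideanSpace ℝ (Fin m)} (hv : ‖v‖ = 1) :
    MeasurePreserving
      (fun ω : Fin m × Fin n → ℝ => WithLp.toLp 2 fun j => ∑ i, v i * ω (i, j))
      (gaussianPi (Fin m × Fin n)) (stdGaussian (EuclideanSpace ℝ (Fin n))) := by
  have hmeas : Measurable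
      (fun ω : Fin m × Fin n → ℝ => WithLp.toLp 2 fun j => ∑ i, v i * ω (i, j)) := by
    fun_prop
  refine ⟨hmeas, ?_⟩
  have : IsProbabilityMeasure ((gaussianPi (Fin m × Fin n)).map
      (fun ω => WithLp.toLp 2 fun j => ∑ i, v i * ω (i, j))) :=
    Measure.isProbabilityMeasure_map hmeas.aemeasurable
  refine Measure.ext_of_charFun ?_
  ext t
  set T : EuclideanSpace ℝ (Fin m × Fin n) := WithLp.toLp 2 fun p => v p.1 * t p.2 with hT
  have hnorm : ‖T‖ ^ 2 = ‖t‖ ^ 2 := by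
    rw [← one_mul (‖t‖ ^ 2), ← one_pow 2, ← hv]
    simp only [EuclideanSpace.real_norm_sq_eq, hT, mul_pow, Fintype.sum_prod_type,
      Finset.sum_mul_sum]
  have h := charFun_stdGaussian T
  rw [← (measurePreserving_toLp (ι := Fin m × Fin n)).map_eq, charFun_apply,
    integral_map (by fun_prop) (by fun_prop)] at h
  rw [charFun_stdGaussian, charFun_apply, integral_map hmeas.aemeasurable (by fun_prop)]
  convert! h using 1
  · refine integral_congr_ae (ae_of_all _ fun ω => ?_)
    simp only
    congr 3
    simp only [PiLp.inner_apply, hT, RCLike.inner_apply, conj_trivial, Finset.mul_sum,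
      Fintype.sum_prod_type]
    rw [Finset.sum_comm]
    exact Finset.sum_congr rfl fun _ _ => Finset.sum_congr rfl fun _ _ => by ring
  · rw [← Complex.ofReal_pow, ← Complex.ofReal_pow, hnorm]

lemma measure_inner_matVec_le {Z : Type*} [Fintype Z] [Nonempty Z] {v : EuclideanSpace ℝ (Fin m)}
    (hv : ‖v‖ = 1) (u : Z → EuclideanSpace ℝ (Fin n)) (hu : ∀ i, ‖u i‖ ≤ 1) {a η : ℝ}
    (hη : 0 ≤ η)
    (hua : ∫ h, Finset.univ.sup' Finset.univ_nonempty (fun i => inner ℝ (u i) h)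
      ∂(stdGaussian (EuclideanSpace ℝ (Fin n))) ≤ a) :
    (gaussianPi (Fin m × Fin n)).real {ω | ∃ i, a + η ≤ inner ℝ (matVec ω (u i)) v} ≤
      Real.exp (-η ^ 2 / 8) := by
  have hmp := measurePreserving_vecMul (n := n) hv
  -- The parameter `η/2` gives the exponent `-η²/4`, better than the `-η²/8` required.
  obtain ⟨-, hi, hle⟩ := integral_exp_mul_sup_inner_le u hu (η / 2)
  set X : EuclideanSpace ℝ (Fin n) → ℝ :=
    fun x => Finset.univ.sup' Finset.univ_nonempty fun z => inner ℝ (u z) x with hX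
  have hXc : Continuous X := Continuous.finset_sup'_apply _ fun i _ => by fun_prop
  have hset : {ω : Fin m × Fin n → ℝ | ∃ i, a + η ≤ inner ℝ (matVec ω (u i)) v} =
      (fun ω : Fin m × Fin n → ℝ => WithLp.toLp 2 fun j => ∑ i, v i * ω (i, j)) ⁻¹'
        {x | a + η ≤ X x} := by
    ext ω
    simp only [Set.mem_ofPred_eq, Set.mem_preimage, hX, Finset.le_sup'_iff, Finset.mem_univ,
      true_and]
    refine exists_congr fun i => ?_
    rw [iff_iff_eq]
    congr 1
    simp only [PiLp.inner_apply, matVec, RCLike.inner_apply, conj_trivial, Finset.mul_sum,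
      Finset.sum_mul]
    rw [Finset.sum_comm]
    exact Finset.sum_congr rfl fun _ _ => Finset.sum_congr rfl fun _ _ => by ring
  rw [hset, measureReal_def, hmp.measure_preimage
    (measurableSet_le measurable_const hXc.measurable).nullMeasurableSet, ← measureReal_def]
  refine (measure_ge_le_exp_mul_mgf (a + η) (by positivity : 0 ≤ η / 2) hi).trans ?_
  calc _ ≤ Real.exp (-(η / 2) * (a + η)) * Real.exp (η / 2 * a + (η / 2) ^ 2 * 1 ^ 2) := by
        unfold mgf
        gcongr
        refine hle.trans ?_
        gcongr
    _ ≤ _ := by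
        rw [← Real.exp_add]
        gcongr
        nlinarith [sq_nonneg η]

/-- Tail bounds for finite families extend to separable families, by monotone convergence. -/
lemma measure_exists_lt_le_of_finite {α X : Type*} [MeasurableSpace α] (μ : Measure α)
    [IsFiniteMeasure μ] [TopologicalSpace X] [TopologicalSpace.SeparableSpace X] [Nonempty X]
    (F : α → X → ℝ) (hF : ∀ ω, Continuous (F ω)) {c K : ℝ}
    (h : ∀ (N : ℕ) (u : Fin (N + 1) → X), μ.real {ω | ∃ i, c ≤ F ω (u i)} ≤ K) :
    μ {ω | ∃ x, c < F ω x} ≤ ENNReal.ofReal K := by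
  set d := TopologicalSpace.denseSeq X
  -- The strict inequality is an open condition on `x`, so it is already met at a point of the dense
  -- sequence.
  have hsub : {ω | ∃ x, c < F ω x} ⊆
      ⋃ N : ℕ, {ω | ∃ i : Fin (N + 1), c ≤ F ω (d i)} := by
    rintro ω ⟨x, hx⟩
    obtain ⟨k, hk⟩ := (TopologicalSpace.denseRange_denseSeq X).exists_mem_open
      (isOpen_lt continuous_const (hF ω)) ⟨x, hx⟩
    exact Set.mem_iUnion.2 ⟨k, Fin.last k, by simpa using hk.le⟩
  have hmono : Monotone fun N : ℕ => {ω | ∃ i : Fin (N + 1), c ≤ F ω (d i)} := by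
    rintro N M hNM ω ⟨i, hi⟩
    exact ⟨⟨i, by omega⟩, hi⟩
  refine (measure_mono hsub).trans ?_
  rw [hmono.measure_iUnion]
  refine iSup_le fun N => ?_
  rw [← ENNReal.ofReal_toReal (measure_ne_top μ _)]
  exact ENNReal.ofReal_le_ofReal (h N fun i => d i)

end Tail

/-! ### The exceptional event for the Gaussian matrix. -/

section Uniform

variable {m n : ℕ} {T T' : Set (EuclideanSpace ℝ (Fin n))}

lemma continuous_matVec_right (ω : Fin m × Fin n → ℝ) :
    Continuous fun v : EuclideanSpace ℝ (Fin n) => matVec ω v := by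
  unfold matVec
  fun_prop

lemma measure_exists_norm_matVec_add_le {σ s : ℝ} (hσ : σ ^ 2 = 1) (hs : s = 1 ∨ s = -1)
    (hT : T ⊆ Metric.closedBall 0 1) (hT' : T' ⊆ Metric.closedBall 0 1) (hne : T.Nonempty)
    (hne' : T'.Nonempty) {a η : ℝ} (hη : 0 ≤ η) (ha : PGD.gaussianWidth T ≤ a)
    (ha' : PGD.gaussianWidth T' ≤ a) :
    gaussianPi (Fin m × Fin n) {ω | ∃ x : T × T', 2 * a + 2 * η < σ *
      (‖matVec ω ((x.1 : EuclideanSpace ℝ (Fin n)) + s • (x.2 : EuclideanSpace ℝ (Fin n)))‖ -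
        (∫ g, ‖g‖ ∂(stdGaussian (EuclideanSpace ℝ (Fin m)))) *
          ‖(x.1 : EuclideanSpace ℝ (Fin n)) + s • (x.2 : EuclideanSpace ℝ (Fin n))‖)} ≤
      ENNReal.ofReal (2 * Real.exp (-η ^ 2 / 8)) := by
  have := hne.to_subtype
  have := hne'.to_subtype
  refine measure_exists_lt_le_of_finite _ (fun ω (x : T × T') => σ *
      (‖matVec ω ((x.1 : EuclideanSpace ℝ (Fin n)) + s • (x.2 : EuclideanSpace ℝ (Fin n)))‖ -
        (∫ g, ‖g‖ ∂(stdGaussian (EuclideanSpace ℝ (Fin m)))) *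
          ‖(x.1 : EuclideanSpace ℝ (Fin n)) + s • (x.2 : EuclideanSpace ℝ (Fin n))‖))
    (fun ω => ?_) fun N u => ?_
  · have := (continuous_matVec_right ω).comp (g := fun v : EuclideanSpace ℝ (Fin n) => matVec ω v)
      (f := fun x : T × T' =>
        (x.1 : EuclideanSpace ℝ (Fin n)) + s • (x.2 : EuclideanSpace ℝ (Fin n))) (by fun_prop)
    simp only [Function.comp_def] at this
    fun_prop
  · have hw : ∀ j, ‖s • ((u j).2 : EuclideanSpace ℝ (Fin n))‖ ≤ 1 := fun j => by
      have : ‖((u j).2 : EuclideanSpace ℝ (Fin n))‖ ≤ 1 := by simpa using hT' (u j).2.2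
      rcases hs with rfl | rfl <;> simpa using this
    refine le_trans (measureReal_mono ?_ (measure_ne_top _ _))
      (measure_norm_matVec_add_le hσ (fun i => ((u i).1 : EuclideanSpace ℝ (Fin n)))
      (fun i => ((u i).2 : EuclideanSpace ℝ (Fin n)))
      (fun i => by simpa using hT (u i).1.2) hw hη
      ((integral_sup_inner_le_gaussianWidth hT fun i => (u i).1.2).trans ha) ?_)
    · rintro ω ⟨i, hi⟩
      exact ⟨i, i, hi⟩
    · rcases hs with rfl | rfl
      · simpa only [one_smul] using
          (integral_sup_inner_le_gaussianWidth hT' fun i => (u i).2.2).trans ha'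
      · simpa only [neg_one_smul] using
          (integral_sup_inner_neg_le_gaussianWidth hT' fun i => (u i).2.2).trans ha'

lemma measure_exists_inner_matVec_le (w : EuclideanSpace ℝ (Fin m))
    (hT : T ⊆ Metric.closedBall 0 1) (hne : T.Nonempty) {a η : ℝ} (hη : 0 ≤ η)
    (ha : PGD.gaussianWidth T ≤ a) :
    gaussianPi (Fin m × Fin n) {ω | ∃ x : T, (a + η) * ‖w‖ < inner ℝ (matVec ω x.1) w} ≤
      ENNReal.ofReal (Real.exp (-η ^ 2 / 8)) := by
  have := hne.to_subtype
  rcases eq_or_ne w 0 with rfl | hw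
  · simp
  have hw0 : 0 < ‖w‖ := norm_pos_iff.2 hw
  have hv : ‖‖w‖⁻¹ • w‖ = 1 := norm_smul_inv_norm hw
  have hset : {ω : Fin m × Fin n → ℝ | ∃ x : T, (a + η) * ‖w‖ < inner ℝ (matVec ω x.1) w} =
      {ω | ∃ x : T, a + η < inner ℝ (matVec ω x.1) (‖w‖⁻¹ • w)} := by
    ext ω
    refine exists_congr fun x => ?_
    rw [inner_smul_right, lt_inv_mul_iff₀ hw0, mul_comm]
  rw [hset]
  refine measure_exists_lt_le_of_finite _
    (fun ω (x : T) => inner ℝ (matVec ω x.1) (‖w‖⁻¹ • w)) (fun ω => ?_) fun N u => ?_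
  · have := (continuous_matVec_right ω).comp (continuous_subtype_val (p := (· ∈ T)))
    simp only [Function.comp_def] at this
    fun_prop
  · exact measure_inner_matVec_le hv _ (fun i => by simpa using hT (u i).2) hη
      ((integral_sup_inner_le_gaussianWidth hT fun i => (u i).2).trans ha)

/-- Outside of a set of small Gaussian measure, a matrix is almost an isometry, up to scaling, on
the sums and differences of vectors in `T` and in `insert p T`. -/
lemma exists_gaussianPi_le_forall_notMem (w : EuclideanSpace ℝ (Fin m))
    (hT : T ⊆ Metric.closedBall 0 1) (h0 : 0 ∈ T) {p : EuclideanSpace ℝ (Fin n)} (hp : ‖p‖ ≤ 1)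
    {η : ℝ} (hη : 0 ≤ η) :
    ∃ B : Set (Fin m × Fin n → ℝ),
      gaussianPi (Fin m × Fin n) B ≤ ENNReal.ofReal (9 * Real.exp (-η ^ 2 / 8)) ∧
      ∀ ω ∉ B, (∀ u ∈ T, ∀ v ∈ insert p T,
        (∫ g, ‖g‖ ∂(stdGaussian (EuclideanSpace ℝ (Fin m)))) * ‖u + v‖ ≤
          ‖matVec ω (u + v)‖ + 2 * (PGD.gaussianWidth T + η) ∧
        ‖matVec ω (u - v)‖ ≤ (∫ g, ‖g‖ ∂(stdGaussian (EuclideanSpace ℝ (Fin m)))) * ‖u - v‖ +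
          2 * (PGD.gaussianWidth T + η)) ∧
        ∀ u ∈ T, inner ℝ (matVec ω u) w ≤ (PGD.gaussianWidth T + η) * ‖w‖ := by
  have hne : T.Nonempty := ⟨0, h0⟩
  have hP : {p} ⊆ Metric.closedBall (0 : EuclideanSpace ℝ (Fin n)) 1 := by simpa using hp
  have hw0 := gaussianWidth_nonneg hT h0
  have e1 := fun (σ s : ℝ) (hσ : σ ^ 2 = 1) (hs : s = 1 ∨ s = -1) =>
    measure_exists_norm_matVec_add_le (m := m) hσ hs hT hT hne hne hη le_rfl le_rfl
  have e2 := fun (σ s : ℝ) (hσ : σ ^ 2 = 1) (hs : s = 1 ∨ s = -1) =>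
    measure_exists_norm_matVec_add_le (m := m) hσ hs hT hP hne (Set.singleton_nonempty p) hη le_rfl
      ((gaussianWidth_singleton p).trans_le hw0)
  have e3 := measure_exists_inner_matVec_le w hT hne hη le_rfl
  -- Polarization requires only Gordon (`σ = -1`) on sums and Chevet (`σ = 1`) on differences, each
  -- for `T × T` and `T × {p}`. Four events at `2 exp (-η²/8)` and one noise event make up the
  -- factor 9.
  have a1 := e1 (-1) 1 (by norm_num) (Or.inl rfl)
  have a2 := e1 1 (-1) (by norm_num) (Or.inr rfl)
  have a3 := e2 (-1) 1 (by norm_num) (Or.inl rfl)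
  have a4 := e2 1 (-1) (by norm_num) (Or.inr rfl)
  refine ⟨_, (measure_union_le _ _).trans (add_le_add ((measure_union_le _ _).trans
    (add_le_add a1 a2)) ((measure_union_le _ _).trans (add_le_add ((measure_union_le _ _).trans
    (add_le_add a3 a4)) e3))) |>.trans (le_of_eq ?_), fun ω hω => ?_⟩
  · rw [← ENNReal.ofReal_add (by positivity) (by positivity),
      ← ENNReal.ofReal_add (by positivity) (by positivity),
      ← ENNReal.ofReal_add (by positivity) (by positivity)]
    congr 1
    ring
  · simp only [Set.mem_union, Set.mem_ofPred_eq, not_or, not_exists, not_lt, Prod.forall,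
      Subtype.forall, Set.mem_singleton_iff, forall_eq, one_smul, neg_one_smul, one_mul,
      neg_one_mul, ← sub_eq_add_neg] at hω
    obtain ⟨⟨h1, h2⟩, ⟨h3, h4⟩, h5⟩ := hω
    refine ⟨fun u hu v hv => ?_, h5⟩
    rcases hv with rfl | hv
    · have := h3 u hu
      have := h4 u hu
      constructor <;> linarith
    · have := h1 u hu v hv
      have := h2 u hu v hv
      constructor <;> linarith

/-- The entries of a Gaussian map are jointly distributed as a standard Gaussian family. -/
lemma PGD.IsGaussianMap.map_eq {Ω : Type*} [MeasurableSpace Ω] {P : Measure Ω}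
    [IsProbabilityMeasure P] {A : Ω → Matrix (Fin m) (Fin n) ℝ} (hA : PGD.IsGaussianMap A P) :
    AEMeasurable (fun ω (p : Fin m × Fin n) => A ω p.1 p.2) P ∧
      P.map (fun ω (p : Fin m × Fin n) => A ω p.1 p.2) = gaussianPi (Fin m × Fin n) := by
  have hm : ∀ p : Fin m × Fin n, AEMeasurable (fun ω => A ω p.1 p.2) P :=
    fun p => (hA.hasLaw p.1 p.2).aemeasurable
  refine ⟨aemeasurable_pi_lambda _ hm, ?_⟩
  rw [(iIndepFun_iff_map_fun_eq_pi_map hm).1 hA.indep]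
  simp only [(hA.hasLaw _ _).map_eq]

/-- Stated for arbitrary `B`, since the exceptional set is a union over an uncountable family whose
measurability is not established. -/
lemma measure_preimage_le_of_map_eq {Ω α : Type*} [MeasurableSpace Ω] [MeasurableSpace α]
    {P : Measure Ω} {μ : Measure α} {X : Ω → α} (hX : AEMeasurable X P) (hμ : P.map X = μ)
    (B : Set α) : P (X ⁻¹' B) ≤ μ B := by
  rw [← measure_toMeasurable B, ← hμ, Measure.map_apply_of_aemeasurable hX
    (measurableSet_toMeasurable _ _)]
  exact measure_mono (Set.preimage_mono (subset_toMeasurable _ _))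

end Uniform

/-! ### Polarization and the linear recursion. -/

section Deterministic

variable {E F : Type*} [NormedAddCommGroup E] [InnerProductSpace ℝ E] [NormedAddCommGroup F]
  [InnerProductSpace ℝ F]

/-- An almost isometry on sums and differences almost preserves inner products. -/
lemma inner_sub_inner_map_le (L : E →ₗ[ℝ] F) {b δ : ℝ} (hb : 0 < b) (hδ : 0 ≤ δ)
    (hδb : δ ≤ 4 / 5 * b) {u v : E} (hu : ‖u‖ ≤ 1) (hv : ‖v‖ ≤ 1)
    (hadd : b * ‖u + v‖ ≤ ‖L (u + v)‖ + δ) (hsub : ‖L (u - v)‖ ≤ b * ‖u - v‖ + δ) :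
    inner ℝ u v - 1 / b ^ 2 * inner ℝ (L u) (L v) ≤ √2 * δ / b := by
  have h2 : (1.41 : ℝ) ≤ √2 := Real.le_sqrt_of_sq_le (by norm_num)
  have h22 : √2 ^ 2 = 2 := Real.sq_sqrt (by norm_num)
  have e1 : inner ℝ u v = (‖u + v‖ ^ 2 - ‖u - v‖ ^ 2) / 4 := by
    rw [norm_add_sq_real, norm_sub_sq_real]; ring
  have e2 : inner ℝ (L u) (L v) = (‖L (u + v)‖ ^ 2 - ‖L (u - v)‖ ^ 2) / 4 := by
    rw [map_add, map_sub, norm_add_sq_real, norm_sub_sq_real]; ring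
  have e3 : ‖u + v‖ ^ 2 + ‖u - v‖ ^ 2 ≤ 4 := by
    rw [norm_add_sq_real, norm_sub_sq_real]
    nlinarith [norm_nonneg u, norm_nonneg v]
  rw [e1, e2]
  have hs := norm_nonneg (u + v)
  have ht := norm_nonneg (u - v)
  have hLs := norm_nonneg (L (u + v))
  have hLt := norm_nonneg (L (u - v))
  generalize ‖u + v‖ = s at *
  generalize ‖u - v‖ = t at *
  generalize ‖L (u + v)‖ = p at *
  generalize ‖L (u - v)‖ = q at *
  -- The parallelogram law gives `s² + t² ≤ 4`, and this is where `√2` in the rate comes from.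
  have hst : s + t ≤ 2 * √2 := abs_le_of_sq_le_sq' (by nlinarith [sq_nonneg (s - t)])
    (by positivity) |>.2
  have hq : q ^ 2 ≤ (b * t + δ) ^ 2 := by gcongr
  have key : b ^ 2 * (s ^ 2 - t ^ 2) - (p ^ 2 - q ^ 2) ≤ 4 * √2 * δ * b := by
    -- If `δ ≤ b s`, the two `δ²` terms cancel and `2 b δ (s + t)` remains. Otherwise the lower
    -- bound on `p` is vacuous, and the crude bound `δ (2δ + 2 b t)` with `t ≤ 2` suffices: `δ ≤
    -- 4b/5` gives `8/5 + 4 = 5.6 < 4 · 1.41`.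
    rcases le_total δ (b * s) with h | h
    · have hp : (b * s - δ) ^ 2 ≤ p ^ 2 := by
        have : 0 ≤ b * s - δ := by linarith
        gcongr
        linarith
      nlinarith [mul_le_mul_of_nonneg_left hst (mul_nonneg hδ hb.le)]
    · have ht2 : t ≤ 2 := abs_le_of_sq_le_sq' (by nlinarith [sq_nonneg s]) (by norm_num) |>.2
      have h1 : (b * s) ^ 2 ≤ δ * δ := by nlinarith [mul_nonneg hb.le hs]
      have h3 : b * t ≤ b * 2 := by gcongr
      have h4 : 1.41 * b ≤ √2 * b := by gcongr
      have h5 : δ * (δ + 2 * (b * t) + δ) ≤ δ * (4 * √2 * b) := by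
        gcongr
        linarith
      nlinarith [sq_nonneg p]
  rw [show (s ^ 2 - t ^ 2) / 4 - 1 / b ^ 2 * ((p ^ 2 - q ^ 2) / 4) =
    (b ^ 2 * (s ^ 2 - t ^ 2) - (p ^ 2 - q ^ 2)) / (4 * b ^ 2) by field_simp,
    show √2 * δ / b = (4 * √2 * δ * b) / (4 * b ^ 2) by field_simp]
  gcongr

lemma le_pow_mul_add_div_of_le {r : ℕ → ℝ} {ρ c : ℝ} (hρ : 0 ≤ ρ) (hρ1 : ρ < 1) (hc : 0 ≤ c)
    (h : ∀ k, r (k + 1) ≤ ρ * r k + c) (k : ℕ) : r k ≤ ρ ^ k * r 0 + c / (1 - ρ) := by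
  have h1 : 0 < 1 - ρ := by linarith
  induction k with
  | zero => simpa using div_nonneg hc h1.le
  | succ k ih =>
    calc _ ≤ ρ * r k + c := h k
      _ ≤ ρ * (ρ ^ k * r 0 + c / (1 - ρ)) + c := by gcongr
      _ = _ := by field_simp; ring

end Deterministic

/-! ### Projected gradient descent. -/

namespace PGD

variable {m n : ℕ}

lemma kappa_pos (f : EuclideanSpace ℝ (Fin n) → ℝ) : 0 < kappa f := by
  unfold kappa
  split_ifs <;> norm_num

lemma one_le_kappa (f : EuclideanSpace ℝ (Fin n) → ℝ) : 1 ≤ kappa f := by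
  unfold kappa
  split_ifs <;> norm_num

/-- The projection onto a sub-level set. -/
lemma IsProjection.norm_sub_sq_le {f : EuclideanSpace ℝ (Fin n) → ℝ}
    {x v p : EuclideanSpace ℝ (Fin n)} (h : IsProjection {z | f z ≤ f x} v p) :
    ‖p - x‖ ^ 2 ≤ kappa f * inner ℝ (v - x) (p - x) := by
  obtain ⟨hp, hmin⟩ := h
  unfold kappa
  split_ifs with hf
  -- For convex `f` the variational inequality of the projection gives the factor 1; otherwise
  -- comparing `p` with the competitor `x` and expanding squares gives 2.
  · have hK : Convex ℝ {z | f z ≤ f x} := by simpa using hf.convex_le (f x)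
    have hx : x ∈ {z | f z ≤ f x} := le_refl (f x)
    have : Nonempty {z | f z ≤ f x} := ⟨x, hx⟩
    have heq : ‖v - p‖ = ⨅ w : {z | f z ≤ f x}, ‖v - w‖ :=
      le_antisymm (le_ciInf fun w => hmin w w.2)
        (ciInf_le ⟨0, by rintro _ ⟨w, rfl⟩; exact norm_nonneg _⟩ (⟨p, hp⟩ : {z | f z ≤ f x}))
    have h := (norm_eq_iInf_iff_real_inner_le_zero hK hp).1 heq x hx
    rw [show v - p = (v - x) - (p - x) by abel, show x - p = -(p - x) by abel, inner_neg_right,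
      inner_sub_left, real_inner_self_eq_norm_sq] at h
    linarith
  · have h := hmin x (le_refl (f x))
    rw [show v - p = (v - x) - (p - x) by abel] at h
    have h' := pow_le_pow_left₀ (norm_nonneg _) h 2
    rw [norm_sub_sq_real] at h'
    linarith

lemma inner_transpose_toEuclideanLin (A : Matrix (Fin m) (Fin n) ℝ) (y : EuclideanSpace ℝ (Fin m))
    (z : EuclideanSpace ℝ (Fin n)) :
    inner ℝ (A.transpose.toEuclideanLin y) z = inner ℝ y (A.toEuclideanLin z) := by
  rw [← Matrix.conjTranspose_eq_transpose_of_trivial,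
    Matrix.toEuclideanLin_conjTranspose_eq_adjoint, LinearMap.adjoint_inner_left]

lemma matVec_eq_toEuclideanLin (A : Matrix (Fin m) (Fin n) ℝ) (v : EuclideanSpace ℝ (Fin n)) :
    matVec (fun p : Fin m × Fin n => A p.1 p.2) v = A.toEuclideanLin v := by
  ext i
  simp [matVec, Matrix.toLpLin_apply, Matrix.mulVec, dotProduct]

lemma phi_le_sqrt_div_mul_phi {s t : ℝ} (hs : 0 ≤ s) (hst : s ≤ t) (ht : 0 < t) :
    phi s ≤ √(s / t) * phi t := by
  have h1 := phi_pos ht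
  rcases hs.eq_or_lt with rfl | hs
  · simp [phi_zero]
  · have h := phi_sq_div_mono hs hst
    refine abs_le_of_sq_le_sq' ?_ (by positivity) |>.2
    rw [mul_pow, Real.sq_sqrt (by positivity)]
    rw [div_le_div_iff₀ hs ht] at h
    rw [div_mul_eq_mul_div, le_div_iff₀ ht]
    linarith

/-- The noise coefficient: `φ(s) ≤ √(s/t) φ(t)` cancels one factor `φ(t)`, and `φ(t) ≥ √(2t/π)`
bounds the other. -/
lemma phi_div_phi_sq_le {s t : ℝ} (hs : 0 ≤ s) (hst : s ≤ t) (ht : 1 ≤ t) :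
    phi s / phi t ^ 2 ≤ √(Real.pi / 2) * (√s / t) := by
  have h0 : 0 < t := by linarith
  have h1 := phi_pos h0
  have hpi := Real.pi_pos
  have h2 : √t ≤ √(Real.pi / 2) * phi t := by
    refine Real.sqrt_le_iff.2 ⟨by positivity, ?_⟩
    rw [mul_pow, Real.sq_sqrt (by positivity)]
    have := two_div_pi_mul_le_phi_sq ht
    calc t = Real.pi / 2 * (2 / Real.pi * t) := by field_simp
      _ ≤ _ := by gcongr
  have h3 : 0 < √t := Real.sqrt_pos.2 h0
  calc phi s / phi t ^ 2 ≤ √(s / t) * phi t / phi t ^ 2 := by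
        gcongr
        exact phi_le_sqrt_div_mul_phi hs hst h0
    _ = √s / √t * (1 / phi t) := by rw [Real.sqrt_div hs]; field_simp
    _ ≤ √s / √t * (√(Real.pi / 2) / √t) := by
        refine mul_le_mul_of_nonneg_left ?_ (by positivity)
        rw [div_le_div_iff₀ h1 h3]
        linarith
    _ = _ := by
        rw [div_mul_div_comm, Real.mul_self_sqrt h0.le]
        ring

/-- One step of projected gradient descent. -/
lemma norm_sub_le_of_isProjection {f : EuclideanSpace ℝ (Fin n) → ℝ}
    {x z z' : EuclideanSpace ℝ (Fin n)} {w : EuclideanSpace ℝ (Fin m)}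
    {A : Matrix (Fin m) (Fin n) ℝ} {b δ : ℝ} (hb : 0 < b) (hδ : 0 ≤ δ) (hδb : δ ≤ 4 / 5 * b)
    (hz : IsProjection {v | f v ≤ f x}
      (z + (1 / b ^ 2) • A.transpose.toEuclideanLin
        (A.toEuclideanLin x + w - A.toEuclideanLin z)) z')
    (hadd : b * ‖‖z' - x‖⁻¹ • (z' - x) + ‖z - x‖⁻¹ • (z - x)‖ ≤
      ‖A.toEuclideanLin (‖z' - x‖⁻¹ • (z' - x) + ‖z - x‖⁻¹ • (z - x))‖ + δ)
    (hsub : ‖A.toEuclideanLin (‖z' - x‖⁻¹ • (z' - x) - ‖z - x‖⁻¹ • (z - x))‖ ≤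
      b * ‖‖z' - x‖⁻¹ • (z' - x) - ‖z - x‖⁻¹ • (z - x)‖ + δ)
    (hw : inner ℝ (A.toEuclideanLin (‖z' - x‖⁻¹ • (z' - x))) w ≤ δ / 2 * ‖w‖) :
    ‖z' - x‖ ≤ kappa f * (√2 * δ / b) * ‖z - x‖ + kappa f * (δ / 2 / b ^ 2) * ‖w‖ := by
  have hκ := kappa_pos f
  have h := hz.norm_sub_sq_le
  have hsplit : z + (1 / b ^ 2) • A.transpose.toEuclideanLin
      (A.toEuclideanLin x + w - A.toEuclideanLin z) - x =
      (z - x) + (1 / b ^ 2) • A.transpose.toEuclideanLin (w - A.toEuclideanLin (z - x)) := by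
    rw [map_sub A.toEuclideanLin, show A.toEuclideanLin x + w - A.toEuclideanLin z =
      w - (A.toEuclideanLin z - A.toEuclideanLin x) by abel]
    abel
  have hunit : ∀ y : EuclideanSpace ℝ (Fin n), ‖‖y‖⁻¹ • y‖ ≤ 1 := fun y => by
    rw [norm_smul, norm_inv, norm_norm]
    exact inv_mul_le_one
  have hin := inner_sub_inner_map_le A.toEuclideanLin hb hδ hδb (hunit (z' - x)) (hunit (z - x))
    hadd hsub
  rw [hsplit] at h
  generalize z - x = d at *
  generalize z' - x = d' at *
  rcases eq_or_ne d' 0 with rfl | hd'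
  · rw [norm_zero]
    positivity
  have hd'0 : 0 < ‖d'‖ := norm_pos_iff.2 hd'
  have hd : inner ℝ d d' - 1 / b ^ 2 * inner ℝ (A.toEuclideanLin d) (A.toEuclideanLin d') ≤
      √2 * δ / b * ‖d‖ * ‖d'‖ := by
    rcases eq_or_ne d 0 with rfl | hd
    · simp
    have hd0 : 0 < ‖d‖ := norm_pos_iff.2 hd
    simp only [map_smul, inner_smul_left, inner_smul_right, conj_trivial] at hin
    have := mul_le_mul_of_nonneg_right hin (mul_nonneg hd0.le hd'0.le)
    rw [real_inner_comm d, real_inner_comm (A.toEuclideanLin d)] at this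
    calc _ = _ := ?_
      _ ≤ _ := this
      _ = _ := by ring
    field_simp
  have hw' : inner ℝ w (A.toEuclideanLin d') ≤ δ / 2 * ‖w‖ * ‖d'‖ := by
    rw [map_smul, inner_smul_left, conj_trivial, inv_mul_le_iff₀ hd'0, real_inner_comm] at hw
    linarith
  rw [inner_add_left, inner_smul_left, inner_transpose_toEuclideanLin, conj_trivial,
    inner_sub_left] at h
  refine le_of_mul_le_mul_right ?_ hd'0
  calc ‖d'‖ * ‖d'‖ = ‖d'‖ ^ 2 := by ring
    _ ≤ _ := h
    _ = kappa f * ((inner ℝ d d' -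
          1 / b ^ 2 * inner ℝ (A.toEuclideanLin d) (A.toEuclideanLin d')) +
          1 / b ^ 2 * inner ℝ w (A.toEuclideanLin d')) := by ring
    _ ≤ kappa f * (√2 * δ / b * ‖d‖ * ‖d'‖ + 1 / b ^ 2 * (δ / 2 * ‖w‖ * ‖d'‖)) := by gcongr
    _ = _ := by ring

end PGD

theorem theorem2 {m n : ℕ} {Ω : Type*} [MeasurableSpace Ω] (P : Measure Ω) [IsProbabilityMeasure P]
    (A : Ω → Matrix (Fin m) (Fin n) ℝ) (hA : PGD.IsGaussianMap A P)
    (x : EuclideanSpace ℝ (Fin n)) (w : EuclideanSpace ℝ (Fin m))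
    (f : EuclideanSpace ℝ (Fin n) → ℝ) (hf : PGD.IsProperFun f)
    (C : Set (EuclideanSpace ℝ (Fin n))) (hC : PGD.IsDescentCone f x C)
    (η : ℝ) (hη : 0 ≤ η) (m₀ : ℝ) (hm₀ : m₀ = PGD.phaseTransition C η)
    (hm : (m : ℝ) > 8 * PGD.kappa f ^ 2 * m₀) :
    ∃ S : Set Ω, MeasurableSet S ∧
      ENNReal.ofReal (1 - 9 * Real.exp (-η ^ 2 / 8)) ≤ P S ∧
      ∀ ω ∈ S, ∀ z : ℕ → EuclideanSpace ℝ (Fin n),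
        PGD.IsPGDRun {v | f v ≤ f x} (A ω) ((A ω).toEuclideanLin x + w) (1 / PGD.phi m ^ 2) z →
        ∀ τ : ℕ,
          ‖z τ - x‖ ≤ (8 * PGD.kappa f ^ 2 * m₀ / m) ^ ((τ : ℝ) / 2) * ‖x‖ +
            √(Real.pi / 2) * (PGD.kappa f / (1 - √(8 * PGD.kappa f ^ 2 * (m₀ / m)))) *
              (√m₀ / m) * ‖w‖ := by
  set κ := PGD.kappa f with hκdef
  have hκ : 1 ≤ κ := PGD.one_le_kappa f
  set T := C ∩ Metric.closedBall 0 1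
  have hT : T ⊆ Metric.closedBall 0 1 := Set.inter_subset_right
  have h0 : (0 : EuclideanSpace ℝ (Fin n)) ∈ T :=
    ⟨hC.descentSet_subset (by simp [PGD.descentSet]), by simp⟩
  have hW := gaussianWidth_nonneg hT h0
  have hex := exists_phi_eq (add_nonneg hW hη)
  have hm₀0 : 0 ≤ m₀ := hm₀ ▸ Function.invFunOn_mem hex
  have hφ : PGD.phi m₀ = PGD.gaussianWidth T + η := hm₀ ▸ Function.invFunOn_eq hex
  have hm0 : (0 : ℝ) < m := lt_of_le_of_lt (by positivity) hm
  have hm1 : (1 : ℝ) ≤ m := by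
    have : 0 < m := by exact_mod_cast hm0
    exact_mod_cast this
  have hm8 : 8 * m₀ ≤ m := by nlinarith [mul_le_mul hκ hκ zero_le_one (by linarith)]
  have hmm : m₀ ≤ m := by linarith
  have hb : ∫ g, ‖g‖ ∂(stdGaussian (EuclideanSpace ℝ (Fin m))) = PGD.phi m := by
    have : NeZero m := ⟨by rintro rfl; simp at hm0⟩
    rw [integral_norm_stdGaussian, finrank_euclideanSpace_fin]
  have hb0 := phi_pos hm0
  set ρ := √(8 * κ ^ 2 * (m₀ / m)) with hρ
  have hρκ : κ * (√8 * √(m₀ / m)) = ρ := by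
    rw [hρ, Real.sqrt_mul (by positivity), Real.sqrt_mul (by positivity),
      Real.sqrt_sq (by linarith)]
    ring
  have hρ1 : ρ < 1 := by
    rw [hρ, Real.sqrt_lt' one_pos, ← mul_div_assoc, div_lt_iff₀ hm0]
    linarith
  -- The extra point is the direction of `z 0 - x = -x`.
  obtain ⟨B, hB, hgood⟩ := exists_gaussianPi_le_forall_notMem w hT h0
    (p := ‖-x‖⁻¹ • (-x)) (by rw [norm_smul, norm_inv, norm_norm]; exact inv_mul_le_one) hη
  obtain ⟨hAm, hAlaw⟩ := hA.map_eq
  set X := fun ω (p : Fin m × Fin n) => A ω p.1 p.2 with hX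
  have hPB : P (toMeasurable P (X ⁻¹' B)) ≤ ENNReal.ofReal (9 * Real.exp (-η ^ 2 / 8)) := by
    rw [measure_toMeasurable]
    exact (measure_preimage_le_of_map_eq hAm hAlaw B).trans hB
  refine ⟨(toMeasurable P (X ⁻¹' B))ᶜ, (measurableSet_toMeasurable _ _).compl, ?_, ?_⟩
  · rw [prob_compl_eq_one_sub (measurableSet_toMeasurable _ _), ENNReal.ofReal_sub _ (by positivity),
      ENNReal.ofReal_one]
    exact tsub_le_tsub_left hPB 1
  intro ω hω z hz τ
  obtain ⟨hiso, hnoise⟩ := hgood (X ω) fun h => hω (subset_toMeasurable _ _ h)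
  simp only [hX, PGD.matVec_eq_toEuclideanLin, hb, ← hφ] at hiso hnoise
  have hunit : ∀ y : EuclideanSpace ℝ (Fin n), ‖‖y‖⁻¹ • y‖ ≤ 1 := fun y => by
    rw [norm_smul, norm_inv, norm_norm]
    exact inv_mul_le_one
  -- From index 1 on, the iterates lie in the sub-level set, so their errors lie in the descent set.
  -- A zero error has direction 0, as `0⁻¹ = 0`, and this belongs to `T`.
  have hmem : ∀ k, ‖z (k + 1) - x‖⁻¹ • (z (k + 1) - x) ∈ T := fun k => by
    refine ⟨?_, by simpa using hunit _⟩
    rcases eq_or_ne (z (k + 1) - x) 0 with h | h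
    · rw [h, smul_zero]
      exact h0.1
    · refine hC.smul_mem _ (inv_pos.2 (norm_pos_iff.2 h)) _ (hC.descentSet_subset ?_)
      have := (hz.succ k).1
      simpa [PGD.descentSet] using this
  have hmem' : ∀ k, ‖z k - x‖⁻¹ • (z k - x) ∈ insert (‖-x‖⁻¹ • (-x)) T := fun k => by
    cases k with
    | zero => simp [hz.zero]
    | succ k => exact Or.inr (hmem k)
  have hφ0 : 0 ≤ PGD.phi m₀ := hφ ▸ add_nonneg hW hη
  have hq := PGD.phi_le_sqrt_div_mul_phi hm₀0 hmm hm0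
  -- Since `m₀/m ≤ 1/8 < 4/25`, this yields `2 φ(m₀) ≤ (4/5) φ(m)`, the smallness condition on `δ`.
  have hs8 : √(m₀ / m) ≤ 2 / 5 := by
    refine Real.sqrt_le_iff.2 ⟨by norm_num, ?_⟩
    rw [div_le_iff₀ hm0]
    linarith
  have hstep : ∀ k, ‖z (k + 1) - x‖ ≤ ρ * ‖z k - x‖ +
      κ * (√(Real.pi / 2) * (√m₀ / m)) * ‖w‖ := fun k => by
    have hi := hiso _ (hmem k) _ (hmem' k)
    refine (PGD.norm_sub_le_of_isProjection (δ := 2 * PGD.phi m₀) hb0 (by positivity)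
      (by nlinarith) (hz.succ k) hi.1 hi.2 (by simpa using hnoise _ (hmem k))).trans ?_
    rw [← hκdef, mul_div_cancel_left₀ _ (two_ne_zero' ℝ)]
    have h8 : √(8 : ℝ) = √2 * 2 := by
      rw [show (8 : ℝ) = 2 * 2 ^ 2 by norm_num, Real.sqrt_mul (by norm_num),
        Real.sqrt_sq (by norm_num)]
    rw [← hρκ, h8]
    gcongr ?_ * _ + κ * ?_ * _
    · refine mul_le_mul_of_nonneg_left ?_ (by linarith)
      rw [div_le_iff₀ hb0]
      calc _ = √2 * 2 * PGD.phi m₀ := by ring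
        _ ≤ √2 * 2 * (√(m₀ / m) * PGD.phi m) := by gcongr
        _ = _ := by ring
    · exact PGD.phi_div_phi_sq_le hm₀0 hmm hm1
  have h := le_pow_mul_add_div_of_le (r := fun k => ‖z k - x‖) (Real.sqrt_nonneg _) hρ1
    (by positivity) hstep τ
  simp only [hz.zero, zero_sub, norm_neg] at h
  refine h.trans (le_of_eq ?_)
  congr 2
  · rw [← mul_div_assoc, Real.sqrt_eq_rpow, ← Real.rpow_natCast,
      ← Real.rpow_mul (by positivity)]
    congr 1
    ring
  · ring
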